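/- Let $m,n,\ell\ge 0$, let $[m]$ be a set of indivisible goods that is partitioned into categories $C_1,\dots,C_\ell$ with thresholds $k_1,\dots,k_\ell\in\mathbb{N}$, and let each agent $i\in[n]$ have an additive valuation $v_i(S)=\sum_{g\in S}v_i(g)$, $S\subseteq[m]$, with real numbers $v_i(g)\ge 0$. Let $\mathcal{F}$ be the set of feasible allocations, i.e. of the partitions $(A_1,\dots,A_n)$ of $[m]$ into $n$ (possibly empty) bundles with $|A_i\cap C_h|\le k_h$ for all $i\in[n]$ and $h\in[\ell]$, and let $$\mathrm{CMMS}_i=\max_{(P_1,\dots,P_n)\in\mathcal{F}}\ \min_{j\in[n]}v_i(P_j)$$ be the constrained maximin share of agent $i$. Theorem. There is a single algorithm that, for every such instance with $\mathcal{F}\neq\emptyset$, computes in polynomial time a $1/3$-$\mathrm{MMS}$ allocation, i.e. a feasible allocation $(A_1,\dots,A_n)\in\mathcal{F}$ with $v_i(A_i)\ge\frac13\,\mathrm{CMMS}_i$ for all $i\in[n]$. Here the algorithm is a random access machine program whose elementary operations are memory accesses, additions, subtractions and comparisons of natural numbers and of real numbers, and the number of its steps is bounded by a polynomial in $m+n+\ell$.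 (Since there are no multiplications, on rational inputs this is polynomial time in the bit length of the input in the usual sense.) -/

import Mathlib

/-! ## Fair division under cardinality constraints -/

/-- A fair division instance with `m` goods, `n` agents and `ℓ` categories.  The categories are the
fibres `C_h` of `cat`; `k h` is the threshold of category `h`; `v i g` is the value of the good `g`
for the agent `i`, and valuations are extended additively to sets of goods (see `value`). -/
structure FairInstance (m n ℓ : ℕ) where
  cat : Fin m → Fin ℓ
  k : Fin ℓ → ℕ
  v : Fin n → Fin m → ℝ
  v_nonneg : ∀ i g, 0 ≤ v i g

namespace FairInstance

variable {m n ℓ : ℕ} (I : FairInstance m n ℓ)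

/-- The category `C_h`. -/
def category (h : Fin ℓ) : Finset (Fin m) :=
  Finset.univ.filter fun g => I.cat g = h

/-- The additive valuation of agent `i`. -/
def value (i : Fin n) (S : Finset (Fin m)) : ℝ :=
  ∑ g ∈ S, I.v i g

/-- The set `𝓕` of feasible allocations: the `n`-partitions `(A_1, …, A_n)` of the set of goods
(bundles may be empty) with `|A_i ∩ C_h| ≤ k_h` for all agents `i` and categories `h`. -/
def feasible : Set (Fin n → Finset (Fin m)) :=
  {A | (∀ g, ∃! i, g ∈ A i) ∧ ∀ i h, (A i ∩ I.category h).card ≤ I.k h}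

/-- The constrained maximin share of agent `i`: the maximum over all feasible allocations `P` of
`min_j v_i(P_j)`.  There are finitely many allocations, and finitely many bundles (at least one,
because of `i`), so that both extrema are attained as soon as `𝓕` is nonempty. -/
noncomputable def CMMS (i : Fin n) : ℝ :=
  ⨆ P : I.feasible, ⨅ j : Fin n, I.value i (P.1 j)

/-- `A` is an `α`-MMS allocation: it is feasible, and each agent gets at least `α` times her
constrained maximin share. -/
def IsMMS (α : ℝ) (A : Fin n → Finset (Fin m)) : Prop :=
  A ∈ I.feasible ∧ ∀ i, α * I.CMMS i ≤ I.value i (A i)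

end FairInstance

/-! ## A random access machine over the integers and the reals

Programs are while-programs over a random access memory with natural number cells and real cells.
The cells form named arrays with two indices: a program names finitely many arrays, and indices are
computed at run time (indirect addressing).  Every elementary operation has unit cost.  The only
arithmetic operations are addition, subtraction and comparison; there is no multiplication,
division or rounding, reals can not be turned into natural numbers, and the only real constant is
`0`.  So on rational inputs `t` operations lengthen the numbers (written over a common denominator
of the inputs) by at most `t` bits each, and polynomially many steps are polynomial time in the
usual sense. -/

namespace RAM

/-- The contents of the memory: `nat a x y` and `real a x y` are the cells with indices `x`, `y` of
the natural number array and of the real array with the name `a`. -/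
structure Mem where
  nat : ℕ → ℕ → ℕ → ℕ
  real : ℕ → ℕ → ℕ → ℝ

/-- Natural number expressions. -/
inductive NExp where
  | const (c : ℕ)
  | get (a : ℕ) (x y : NExp)
  | add (e f : NExp)
  | sub (e f : NExp)

namespace NExp

/-- The value; the subtraction of natural numbers is truncated at `0`. -/
def eval (s : Mem) : NExp → ℕ
  | const c => c
  | get a x y => s.nat a (eval s x) (eval s y)
  | add e f => eval s e + eval s f
  | sub e f => eval s e - eval s f

/-- The number of operations needed to evaluate the expression. -/
def cost : NExp → ℕ
  | const _ => 1
  | get _ x y => cost x + cost y + 1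
  | add e f => cost e + cost f + 1
  | sub e f => cost e + cost f + 1

end NExp

/-- Real expressions. -/
inductive RExp where
  | zero
  | get (a : ℕ) (x y : NExp)
  | add (e f : RExp)
  | sub (e f : RExp)

namespace RExp

/-- The value. -/
noncomputable def eval (s : Mem) : RExp → ℝ
  | zero => 0
  | get a x y => s.real a (x.eval s) (y.eval s)
  | add e f => eval s e + eval s f
  | sub e f => eval s e - eval s f

/-- The number of operations needed to evaluate the expression. -/
def cost : RExp → ℕ
  | zero => 1
  | get _ x y => x.cost + y.cost + 1
  | add e f => cost e + cost f + 1
  | sub e f => cost e + cost f + 1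

end RExp

/-- Tests. -/
inductive Test where
  | ltN (e f : NExp)
  | ltR (e f : RExp)
  | not (b : Test)
  | and (b c : Test)

namespace Test

/-- The test succeeds. -/
def Holds (s : Mem) : Test → Prop
  | ltN e f => e.eval s < f.eval s
  | ltR e f => e.eval s < f.eval s
  | not b => ¬ Holds s b
  | and b c => Holds s b ∧ Holds s c

/-- The number of operations needed to evaluate the test. -/
def cost : Test → ℕ
  | ltN e f => e.cost + f.cost + 1
  | ltR e f => e.cost + f.cost + 1
  | not b => cost b + 1
  | and b c => cost b + cost c + 1

end Test

/-- Programs. -/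
inductive Prog where
  | skip
  | setN (a : ℕ) (x y e : NExp)
  | setR (a : ℕ) (x y : NExp) (e : RExp)
  | seq (p q : Prog)
  | ite (b : Test) (p q : Prog)
  | while (b : Test) (p : Prog)

/-- Overwrite one cell of a family of arrays. -/
def update {α : Type} (f : ℕ → ℕ → ℕ → α) (a x y : ℕ) (e : α) : ℕ → ℕ → ℕ → α :=
  fun a' x' y' => if a' = a ∧ x' = x ∧ y' = y then e else f a' x' y'

/-- `Exec p s t s'`: started on the memory `s`, the program `p` halts after exactly `t` steps with
the memory `s'`. -/
inductive Exec : Prog → Mem → ℕ → Mem → Prop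
  | skip (s : Mem) : Exec Prog.skip s 1 s
  | setN (s : Mem) (a : ℕ) (x y e : NExp) :
      Exec (Prog.setN a x y e) s (x.cost + y.cost + e.cost + 1)
        { s with nat := update s.nat a (x.eval s) (y.eval s) (e.eval s) }
  | setR (s : Mem) (a : ℕ) (x y : NExp) (e : RExp) :
      Exec (Prog.setR a x y e) s (x.cost + y.cost + e.cost + 1)
        { s with real := update s.real a (x.eval s) (y.eval s) (e.eval s) }
  | seq {p q : Prog} {s s' s'' : Mem} {t t' : ℕ} :
      Exec p s t s' → Exec q s' t' s'' → Exec (Prog.seq p q) s (t + t') s''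
  | ite_pos {b : Test} {p q : Prog} {s s' : Mem} {t : ℕ} :
      b.Holds s → Exec p s t s' → Exec (Prog.ite b p q) s (b.cost + t + 1) s'
  | ite_neg {b : Test} {p q : Prog} {s s' : Mem} {t : ℕ} :
      ¬ b.Holds s → Exec q s t s' → Exec (Prog.ite b p q) s (b.cost + t + 1) s'
  | while_pos {b : Test} {p : Prog} {s s' s'' : Mem} {t t' : ℕ} :
      b.Holds s → Exec p s t s' → Exec (Prog.while b p) s' t' s'' →
        Exec (Prog.while b p) s (b.cost + t + t' + 1) s''
  | while_neg {b : Test} {p : Prog} {s : Mem} :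
      ¬ b.Holds s → Exec (Prog.while b p) s (b.cost + 1) s

end RAM

namespace FairInstance

variable {m n ℓ : ℕ} (I : FairInstance m n ℓ)

/-- The memory that holds the instance.  Natural number array `0`: the cells `(0,0)`, `(1,0)`,
`(2,0)` hold `m`, `n`, `ℓ`; array `1`: the cell `(g,0)` holds the category of the good `g`;
array `2`: the cell `(h,0)` holds the threshold of the category `h`.  Real array `0`: the cell
`(i,g)` holds the value of the good `g` for the agent `i`.  All other cells hold `0`. -/
noncomputable def input : RAM.Mem where
  nat a x y :=
    if a = 0 ∧ x = 0 ∧ y = 0 then m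
    else if a = 0 ∧ x = 1 ∧ y = 0 then n
    else if a = 0 ∧ x = 2 ∧ y = 0 then ℓ
    else if h : a = 1 ∧ x < m ∧ y = 0 then (I.cat ⟨x, h.2.1⟩ : ℕ)
    else if h : a = 2 ∧ x < ℓ ∧ y = 0 then I.k ⟨x, h.2.1⟩
    else 0
  real a x y :=
    if h : a = 0 ∧ x < n ∧ y < m then I.v ⟨x, h.2.1⟩ ⟨y, h.2.2⟩ else 0

end FairInstance

/-- The bundles that a memory describes as the output: cell `(g,0)` of the natural number array `3`
holds the agent who receives the good `g`. -/
def RAM.Mem.bundles (m n : ℕ) (s : RAM.Mem) : Fin n → Finset (Fin m) :=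
  fun i => Finset.univ.filter fun g => s.nat 3 g 0 = i

/-! Let every agent sort the goods inside each category by value. An index `g` is then read as a
slot, worth to agent `i` what the good `σ i g` is worth, so that all agents rank the slots of a
category in the same way. It suffices to distribute slots. Afterwards the owners exchange slots for
goods of the same category, best slots first, and by pigeonhole an owner always finds an unpicked
good at least as valuable as her slot (`Picked.exists_flag_eq_zero`).

Pad each category `h` with worthless slots to `n * k h` slots. When `r` bundles are gone, a window
of `(n - r) * k h` consecutive slots is left. The next bundle consists of `t h ≤ k h` top slots and
the `k h - t h` lowest slots of each window; it respects the thresholds and leaves a window of the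
next size. An agent accepts it if it is worth at least a third of the average, that is, of her value
of the windows divided by `n - r`. As long as this average is at least her share, acceptance gives
her a third of her share; the point is to keep that invariant for all unsatisfied agents.

In phase `0` only bundles with a single top slot are offered. The invariant then holds for a
combinatorial reason: once `r` top slots are gone, at least `n - r` bundles of any feasible
allocation avoid the corresponding goods, and the windows dominate the contents of those bundles
(`SortedValues.mul_le_total`). If all unsatisfied agents reject all such bundles, no remaining slot
is worth more than a third of the average (`Phase.normal`).

From then on a bundle starts as the bottom layer and trades low slots for top slots one at a time
until somebody accepts, at the latest when it is the top layer (`accepts_of_forall`). For each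
unsatisfied agent it is worth at most the average, so the average of what is left does not fall: the
bottom layer is worth at most the average (`mul_total_succ_le`), and any later bundle is one
rejected by everyone, worth less than a third, enlarged by one slot worth at most a third
(`Normal.succ`).

The program is verified by a weakest precondition calculus in which each loop makes at most `N = m +
n + ℓ` iterations, which also bounds the number of steps by a polynomial in `N`. -/

namespace RAM

/-! ## Weakest preconditions for programs with bounded loops -/

namespace Prog

/-- A bound for the number of steps of a program whose loops make at most `N` iterations. -/
def bound (N : ℕ) : Prog → ℕ
  | skip => 1
  | setN _ x y e => x.cost + y.cost + e.cost + 1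
  | setR _ x y e => x.cost + y.cost + e.cost + 1
  | seq p q => bound N p + bound N q
  | ite b p q => b.cost + (bound N p + bound N q) + 1
  | .while b p => N * (b.cost + bound N p + 1) + (b.cost + 1)

/-- Costs of expressions do not depend on the memory, so `N` enters only as one factor per loop; the
degree is the nesting depth of the loops. -/
theorem exists_polynomial_bound (p : Prog) :
    ∃ T : Polynomial ℕ, ∀ N, T.eval N = p.bound N := by
  induction p with
  | skip => exact ⟨Polynomial.C 1, fun N => by simp [bound]⟩
  | setN a x y e => exact ⟨Polynomial.C (x.cost + y.cost + e.cost + 1), fun N => by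
      rw [Polynomial.eval_C, bound]⟩
  | setR a x y e => exact ⟨Polynomial.C (x.cost + y.cost + e.cost + 1), fun N => by
      rw [Polynomial.eval_C, bound]⟩
  | seq p q hp hq =>
    obtain ⟨T, hT⟩ := hp
    obtain ⟨T', hT'⟩ := hq
    exact ⟨T + T', fun N => by rw [Polynomial.eval_add, hT, hT', bound]⟩
  | ite b p q hp hq =>
    obtain ⟨T, hT⟩ := hp
    obtain ⟨T', hT'⟩ := hq
    exact ⟨Polynomial.C b.cost + (T + T') + Polynomial.C 1, fun N => by
      simp only [Polynomial.eval_add, Polynomial.eval_C, hT, hT', bound]⟩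
  | _ =>
    rename_i b p hp
    obtain ⟨T, hT⟩ := hp
    exact ⟨Polynomial.X * (Polynomial.C b.cost + T + Polynomial.C 1) + Polynomial.C (b.cost + 1),
      fun N => by
        simp only [Polynomial.eval_add, Polynomial.eval_mul, Polynomial.eval_X, Polynomial.eval_C,
          hT, bound]⟩

/-- A precondition that ensures that the program halts with the postcondition `Q`, and that its
loops make at most `N` iterations. -/
def wp (N : ℕ) : Prog → (Mem → Prop) → Mem → Prop
  | skip, Q, s => Q s
  | setN a x y e, Q, s =>
      Q { s with nat := update s.nat a (x.eval s) (y.eval s) (e.eval s) }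
  | setR a x y e, Q, s =>
      Q { s with real := update s.real a (x.eval s) (y.eval s) (e.eval s) }
  | seq p q, Q, s => wp N p (wp N q Q) s
  | ite b p q, Q, s => (b.Holds s → wp N p Q s) ∧ (¬ b.Holds s → wp N q Q s)
  -- The invariant is indexed by the iteration: `J j` forces the test to succeed for `j < K` and to
  -- fail for `j = K`, so the loop runs exactly `K` times and termination needs no separate variant.
  | .while b p, Q, s => ∃ K ≤ N, ∃ J : ℕ → Mem → Prop, J 0 s ∧
      (∀ j < K, ∀ s', J j s' → b.Holds s' ∧ wp N p (J (j + 1)) s') ∧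
      ∀ s', J K s' → ¬ b.Holds s' ∧ Q s'

/-- Soundness of the calculus, for total correctness and running time at once. -/
theorem exists_exec_of_wp {N : ℕ} {p : Prog} {Q : Mem → Prop} {s : Mem} (h : p.wp N Q s) :
    ∃ t s', Exec p s t s' ∧ t ≤ p.bound N ∧ Q s' := by
  induction p generalizing Q s with
  | skip => exact ⟨_, _, .skip s, le_rfl, h⟩
  | setN a x y e => exact ⟨_, _, .setN s a x y e, le_rfl, h⟩
  | setR a x y e => exact ⟨_, _, .setR s a x y e, le_rfl, h⟩
  | seq p q hp hq =>
    obtain ⟨t, s', he, ht, h'⟩ := hp h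
    obtain ⟨t', s'', he', ht', h''⟩ := hq h'
    exact ⟨_, _, .seq he he', add_le_add ht ht', h''⟩
  | ite b p q hp hq =>
    by_cases hb : b.Holds s
    · obtain ⟨t, s', he, ht, h'⟩ := hp (h.1 hb)
      exact ⟨_, _, .ite_pos hb he, by simp only [bound]; omega, h'⟩
    · obtain ⟨t, s', he, ht, h'⟩ := hq (h.2 hb)
      exact ⟨_, _, .ite_neg hb he, by simp only [bound]; omega, h'⟩
  | _ =>
    rename_i b p hp
    obtain ⟨K, hK, J, h0, hstep, hend⟩ := h
    -- Induction on the number `d` of iterations that are still to come.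
    have key : ∀ d j s', j + d = K → J j s' → ∃ t s'', Exec (.while b p) s' t s'' ∧
        t ≤ d * (b.cost + bound N p + 1) + (b.cost + 1) ∧ Q s'' := by
      intro d
      induction d with
      | zero =>
        intro j s' hj hJ
        obtain rfl : j = K := by omega
        exact ⟨_, _, .while_neg (hend s' hJ).1, by omega, (hend s' hJ).2⟩
      | succ d ih =>
        intro j s' hj hJ
        obtain ⟨hb, hw⟩ := hstep j (by omega) s' hJ
        obtain ⟨t, s'', he, ht, h'⟩ := hp hw
        obtain ⟨t', s₃, he', ht', h''⟩ := ih (j + 1) s'' (by omega) h'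
        refine ⟨_, _, .while_pos hb he he', ?_, h''⟩
        rw [Nat.succ_mul]
        omega
    obtain ⟨t, s', he, ht, hQ⟩ := key K 0 s (by omega) h0
    refine ⟨t, s', he, ht.trans ?_, hQ⟩
    simp only [bound]
    gcongr

/-- The natural number arrays that a program may write. -/
def writesN : Prog → List ℕ
  | skip => []
  | setN a _ _ _ => [a]
  | setR _ _ _ _ => []
  | seq p q => writesN p ++ writesN q
  | ite _ p q => writesN p ++ writesN q
  | .while _ p => writesN p

/-- The real arrays that a program may write. -/
def writesR : Prog → List ℕ
  | skip => []
  | setN _ _ _ _ => []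
  | setR a _ _ _ => [a]
  | seq p q => writesR p ++ writesR q
  | ite _ p q => writesR p ++ writesR q
  | .while _ p => writesR p

end Prog

/-- The memories `s` and `s'` differ at most in the arrays that `p` may write. -/
structure Frame (p : Prog) (s s' : Mem) : Prop where
  nat : ∀ a, a ∉ p.writesN → s'.nat a = s.nat a
  real : ∀ a, a ∉ p.writesR → s'.real a = s.real a

theorem Frame.refl (p : Prog) (s : Mem) : Frame p s s :=
  ⟨fun _ _ => rfl, fun _ _ => rfl⟩

theorem Frame.trans {p : Prog} {s s' s'' : Mem} (h : Frame p s s') (h' : Frame p s' s'') :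
    Frame p s s'' :=
  ⟨fun a ha => (h'.nat a ha).trans (h.nat a ha), fun a ha => (h'.real a ha).trans (h.real a ha)⟩

theorem Frame.mono {p q : Prog} {s s' : Mem} (h : Frame p s s')
    (hN : p.writesN ⊆ q.writesN) (hR : p.writesR ⊆ q.writesR) : Frame q s s' :=
  ⟨fun a ha => h.nat a fun h' => ha (hN h'), fun a ha => h.real a fun h' => ha (hR h')⟩

@[simp] theorem update_same_array {α : Type} (f : ℕ → ℕ → ℕ → α) (a x y : ℕ) (e : α)
    (x' y' : ℕ) : update f a x y e a x' y' = if x' = x ∧ y' = y then e else f a x' y' := by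
  simp [update]

theorem update_of_ne {α : Type} (f : ℕ → ℕ → ℕ → α) {a a' : ℕ} (x y : ℕ) (e : α)
    (h : a' ≠ a) : update f a x y e a' = f a' := by
  funext x' y'
  simp [update, h]

namespace Prog

theorem wp_mono {N : ℕ} {p : Prog} {Q R : Mem → Prop} {s : Mem} (h : p.wp N Q s)
    (hQR : ∀ s', Q s' → R s') : p.wp N R s := by
  induction p generalizing Q R s with
  | skip => exact hQR _ h
  | setN a x y e => exact hQR _ h
  | setR a x y e => exact hQR _ h
  | seq p q hp hq => exact hp h fun s' h' => hq h' hQR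
  | ite b p q hp hq => exact ⟨fun hb => hp (h.1 hb) hQR, fun hb => hq (h.2 hb) hQR⟩
  | _ =>
    rename_i b p hp
    obtain ⟨K, hK, J, h0, hstep, hend⟩ := h
    exact ⟨K, hK, J, h0, hstep, fun s' h' => ⟨(hend s' h').1, hQR _ (hend s' h').2⟩⟩

/-- Postconditions and loop invariants need only speak of the arrays that change: everything else is
recovered from the syntactic list of written arrays, membership in which is settled by `decide`. -/
theorem wp_frame {N : ℕ} {p : Prog} {Q : Mem → Prop} {s : Mem} (h : p.wp N Q s) :
    p.wp N (fun s' => Frame p s s' ∧ Q s') s := by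
  induction p generalizing Q s with
  | skip => exact ⟨Frame.refl _ _, h⟩
  | setN a x y e =>
    exact ⟨⟨fun b hb => update_of_ne _ _ _ _ (by simpa [writesN] using hb), fun _ _ => rfl⟩, h⟩
  | setR a x y e =>
    exact ⟨⟨fun _ _ => rfl, fun b hb => update_of_ne _ _ _ _ (by simpa [writesR] using hb)⟩, h⟩
  | seq p q hp hq =>
    refine wp_mono (p := p) (hp h) fun s' h' => wp_mono (p := q) (hq h'.2) fun s'' h'' =>
      ⟨?_, h''.2⟩
    exact (h'.1.mono (q := seq p q) (by simp [writesN]) (by simp [writesR])).trans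
      (h''.1.mono (by simp [writesN]) (by simp [writesR]))
  | ite b p q hp hq =>
    exact ⟨fun hb => wp_mono (hp (h.1 hb)) fun s' h' =>
        ⟨h'.1.mono (by simp [writesN]) (by simp [writesR]), h'.2⟩,
      fun hb => wp_mono (hq (h.2 hb)) fun s' h' =>
        ⟨h'.1.mono (by simp [writesN]) (by simp [writesR]), h'.2⟩⟩
  | _ =>
    rename_i b p hp
    obtain ⟨K, hK, J, h0, hstep, hend⟩ := h
    refine ⟨K, hK, fun j s' => Frame (.while b p) s s' ∧ J j s', ⟨Frame.refl _ _, h0⟩, ?_, ?_⟩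
    · rintro j hj s' ⟨hF, hJ⟩
      refine ⟨(hstep j hj s' hJ).1, wp_mono (hp (hstep j hj s' hJ).2) fun s'' h'' =>
        ⟨hF.trans (h''.1.mono ?_ ?_), h''.2⟩⟩ <;> exact fun _ h => h
    · rintro s' ⟨hF, hJ⟩
      exact ⟨(hend s' hJ).1, hF, (hend s' hJ).2⟩

theorem wp_conseq {N : ℕ} {p : Prog} {Q R : Mem → Prop} {s : Mem} (h : p.wp N Q s)
    (hQR : ∀ s', Frame p s s' → Q s' → R s') : p.wp N R s :=
  wp_mono (wp_frame h) fun s' h' => hQR s' h'.1 h'.2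

theorem wp_seq {N : ℕ} {p q : Prog} {P Q : Mem → Prop} {s : Mem} (hp : p.wp N P s)
    (hq : ∀ s', Frame p s s' → P s' → q.wp N Q s') : (seq p q).wp N Q s :=
  wp_conseq (p := p) hp hq

/-- `for x := 0` to `e - 1` do `p`, with the counter in the cell `(0, 0)` of the array `x`. -/
def forLoop (x : ℕ) (e : NExp) (p : Prog) : Prog :=
  seq (setN x (.const 0) (.const 0) (.const 0))
    (.while (.ltN (.get x (.const 0) (.const 0)) e)
      (seq p (setN x (.const 0) (.const 0)
        (.add (.get x (.const 0) (.const 0)) (.const 1)))))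

/-- The counter equals the iteration index because the body does not write the array `x` and the
limit `e` keeps the value `K`. Initialisation and increment do write the counter, so `J` has to be
insensitive to that cell (`hJ`). -/
theorem wp_forLoop {N K x : ℕ} {e : NExp} {p : Prog} {Q : Mem → Prop} {s : Mem}
    (J : ℕ → Mem → Prop) (hK : K ≤ N) (hx : x ∉ p.writesN)
    (he : ∀ s', Frame (forLoop x e p) s s' → e.eval s' = K)
    (hJ : ∀ j s' i, J j s' → J j { s' with nat := update s'.nat x 0 0 i })
    (h0 : J 0 s)
    (hstep : ∀ j < K, ∀ s', Frame (forLoop x e p) s s' → s'.nat x 0 0 = j → J j s' →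
      p.wp N (J (j + 1)) s')
    (hend : ∀ s', Frame (forLoop x e p) s s' → J K s' → Q s') :
    (forLoop x e p).wp N Q s := by
  have hset : ∀ s' i, Frame (forLoop x e p) s s' →
      Frame (forLoop x e p) s { s' with nat := update s'.nat x 0 0 i } := fun s' i hF =>
    ⟨fun a ha => (update_of_ne _ _ _ _ fun h => ha (by simp [forLoop, writesN, h])).trans
      (hF.nat a ha), hF.real⟩
  refine ⟨K, hK, fun j s' => Frame (forLoop x e p) s s' ∧ s'.nat x 0 0 = j ∧ J j s',
    ⟨hset s 0 (Frame.refl _ _), by simp [NExp.eval], hJ _ _ _ h0⟩, ?_, ?_⟩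
  · rintro j hj s' ⟨hF, hxj, h⟩
    refine ⟨by simpa [Test.Holds, NExp.eval, he s' hF, hxj] using hj, ?_⟩
    refine wp_conseq (p := p) (hstep j hj s' hF hxj h) fun s'' hF' h' => ?_
    have hF'' : Frame (forLoop x e p) s s'' := hF.trans
      (hF'.mono (by intro a; simp +contextual [forLoop, writesN])
        (by intro a; simp +contextual [forLoop, writesR]))
    have hxj' : s''.nat x 0 0 = j := by rw [hF'.nat x hx, hxj]
    exact ⟨hset _ _ hF'', by simp [NExp.eval, hxj'], hJ _ _ _ h'⟩
  · rintro s' ⟨hF, hxj, h⟩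
    refine ⟨?_, hend s' hF h⟩
    simp [Test.Holds, NExp.eval, he s' hF, hxj]

end Prog

/-- The test for equality of natural numbers. -/
def Test.eqN (e f : NExp) : Test :=
  .and (.not (.ltN e f)) (.not (.ltN f e))

@[simp] theorem Test.holds_eqN (s : Mem) (e f : NExp) :
    (Test.eqN e f).Holds s ↔ e.eval s = f.eval s := by
  simp only [eqN, Holds]
  omega

/-- The program does nothing unless the test succeeds. -/
def Prog.cond (b : Test) (p : Prog) : Prog :=
  .ite b p .skip

end RAM

/-! ## Goods that are ordered inside their categories -/

section Slots

open Finset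

/-- The number of goods of the same category that precede the good `g`. -/
def offset (c : ℕ → ℕ) (g : ℕ) : ℕ :=
  Nat.count (fun b => c b = c g) g

theorem offset_lt_offset {c : ℕ → ℕ} {g g' : ℕ} (hc : c g = c g') (h : g < g') :
    offset c g < offset c g' := by
  unfold offset
  rw [hc]
  exact Nat.count_strict_mono hc h

theorem eq_of_offset_eq {c : ℕ → ℕ} {g g' : ℕ} (hc : c g = c g')
    (h : offset c g = offset c g') : g = g' := by
  rcases lt_trichotomy g g' with h' | h' | h'
  · exact absurd h (offset_lt_offset hc h').ne
  · exact h'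
  · exact absurd h (offset_lt_offset hc.symm h').ne'

theorem Nat.exists_count_eq_of_lt {P : ℕ → Prop} [DecidablePred P] {n p : ℕ}
    (h : p < Nat.count P n) : ∃ b < n, P b ∧ Nat.count P b = p := by
  induction n with
  | zero => simp at h
  | succ n ih =>
    by_cases hp : p < Nat.count P n
    · obtain ⟨b, hb, h'⟩ := ih hp
      exact ⟨b, by omega, h'⟩
    · rw [Nat.count_succ] at h
      split_ifs at h with hn
      · exact ⟨n, by omega, hn, by omega⟩
      · omega

/-- The offsets that occur in a category have no gaps. -/
theorem exists_offset_eq_of_lt {c : ℕ → ℕ} {g p : ℕ} (h : p < offset c g) :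
    ∃ b < g, c b = c g ∧ offset c b = p := by
  obtain ⟨b, hb, hc, hp⟩ := Nat.exists_count_eq_of_lt h
  refine ⟨b, hb, hc, ?_⟩
  unfold offset
  rw [hc]
  exact hp

/-- The good `g` has one of the `M * k h` offsets from `lo h` on, where `h` is its category. -/
def Alive (c k lo : ℕ → ℕ) (M g : ℕ) : Prop :=
  lo (c g) ≤ offset c g ∧ offset c g < lo (c g) + M * k (c g)

instance (c k lo : ℕ → ℕ) (M : ℕ) : DecidablePred (Alive c k lo M) :=
  fun _ => inferInstanceAs (Decidable (_ ∧ _))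

/-- The value of the alive goods. -/
noncomputable def total (m : ℕ) (c k lo : ℕ → ℕ) (M : ℕ) (w : ℕ → ℝ) : ℝ :=
  ∑ g ∈ range m with Alive c k lo M g, w g

/-- The value of the good with category `h` and offset `p`, and `0` if there is none. -/
noncomputable def slotValue (m : ℕ) (c : ℕ → ℕ) (w : ℕ → ℝ) (h p : ℕ) : ℝ :=
  ∑ g ∈ range m with c g = h ∧ offset c g = p, w g

/-- The values `w` are nonnegative and non-increasing inside each category. -/
structure SortedValues (m : ℕ) (c : ℕ → ℕ) (w : ℕ → ℝ) : Prop where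
  nonneg : ∀ g < m, 0 ≤ w g
  anti : ∀ g g', g < g' → g' < m → c g = c g' → w g' ≤ w g

variable {m ℓ : ℕ} {c k : ℕ → ℕ} {w : ℕ → ℝ}

theorem slotValue_eq {g : ℕ} (hg : g < m) :
    slotValue m c w (c g) (offset c g) = w g := by
  unfold slotValue
  rw [show (range m).filter (fun b => c b = c g ∧ offset c b = offset c g) = {g} from ?_,
    sum_singleton]
  ext b
  simp only [mem_filter, mem_range, mem_singleton]
  exact ⟨fun h => eq_of_offset_eq h.2.1 h.2.2, fun h => h ▸ ⟨h ▸ hg, rfl, rfl⟩⟩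

theorem SortedValues.slotValue_nonneg (hw : SortedValues m c w) (h p : ℕ) :
    0 ≤ slotValue m c w h p :=
  sum_nonneg fun g hg => hw.nonneg g (by simp at hg; exact hg.1)

/-- The goods occupy an initial segment of the offsets, so the padding by zeros comes only after the
nonnegative, non-increasing values. -/
theorem SortedValues.antitone_slotValue (hw : SortedValues m c w) (h : ℕ) :
    Antitone (slotValue m c w h) := by
  intro p p' hp
  by_cases hex : ∃ g < m, c g = h ∧ offset c g = p'
  · obtain ⟨g, hg, rfl, rfl⟩ := hex
    rcases hp.eq_or_lt with rfl | hlt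
    · exact le_rfl
    obtain ⟨b, hb, hc, rfl⟩ := exists_offset_eq_of_lt hlt
    rw [slotValue_eq hg, ← hc, slotValue_eq (hb.trans hg)]
    exact hw.anti b g hb hg hc
  · refine le_trans (le_of_eq ?_) (hw.slotValue_nonneg h p)
    refine sum_eq_zero fun g hg => ?_
    simp only [mem_filter, mem_range] at hg
    exact absurd ⟨g, hg.1, hg.2⟩ hex

/-- In the coordinates category and offset, the alive goods fill intervals. Comparing totals thus
reduces to comparing sums of an antitone sequence over intervals, one category at a time. -/
theorem total_eq_sum_slotValue (hc : ∀ g < m, c g < ℓ) (lo : ℕ → ℕ) (M : ℕ) :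
    total m c k lo M w =
      ∑ h ∈ range ℓ, ∑ p ∈ Ico (lo h) (lo h + M * k h), slotValue m c w h p := by
  unfold total
  rw [← sum_fiberwise_of_maps_to (t := range ℓ) (g := c)]
  · refine sum_congr rfl fun h _ => ?_
    rw [← sum_fiberwise_of_maps_to (t := Ico (lo h) (lo h + M * k h)) (g := offset c)]
    · refine sum_congr rfl fun p hp => ?_
      unfold slotValue
      refine sum_congr ?_ fun _ _ => rfl
      ext g
      simp only [mem_filter, mem_range, mem_Ico] at hp ⊢
      constructor
      · rintro ⟨⟨⟨h1, _⟩, h2⟩, h3⟩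
        exact ⟨h1, h2, h3⟩
      · rintro ⟨h1, rfl, rfl⟩
        exact ⟨⟨⟨h1, hp⟩, rfl⟩, rfl⟩
    · intro g hg
      simp only [mem_filter] at hg
      rw [← hg.2, mem_Ico]
      exact hg.1.2
  · intro g hg
    simp only [mem_filter, mem_range] at hg ⊢
    exact hc g hg.1

/-- Exchange argument: outside the intersection, `S` has at most as many elements as the interval,
and `f (a + K)` separates the values on the two differences. -/
theorem Antitone.sum_le_sum_Ico {f : ℕ → ℝ} (hf : Antitone f) (h0 : ∀ p, 0 ≤ f p)
    {S : Finset ℕ} {a K : ℕ} (hS : ∀ p ∈ S, a ≤ p) (hK : #S ≤ K) :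
    ∑ p ∈ S, f p ≤ ∑ p ∈ Ico a (a + K), f p := by
  have hcard : #(S \ Ico a (a + K)) ≤ #(Ico a (a + K) \ S) := by
    have h1 := card_sdiff_add_card_inter S (Ico a (a + K))
    have h2 := card_sdiff_add_card_inter (Ico a (a + K)) S
    rw [inter_comm, Nat.card_Ico] at h2
    omega
  have h1 : ∑ p ∈ S \ Ico a (a + K), f p ≤ #(S \ Ico a (a + K)) • f (a + K) := by
    refine sum_le_card_nsmul _ _ _ fun p hp => hf ?_
    simp only [mem_sdiff, mem_Ico] at hp
    have := hS p hp.1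
    omega
  have h2 : #(Ico a (a + K) \ S) • f (a + K) ≤ ∑ p ∈ Ico a (a + K) \ S, f p := by
    refine card_nsmul_le_sum _ _ _ fun p hp => hf ?_
    simp only [mem_sdiff, mem_Ico] at hp
    omega
  have h3 : #(S \ Ico a (a + K)) • f (a + K) ≤ #(Ico a (a + K) \ S) • f (a + K) :=
    nsmul_le_nsmul_left (h0 _) hcard
  have h4 := sum_inter_add_sum_sdiff S (Ico a (a + K)) f
  have h5 := sum_inter_add_sum_sdiff (Ico a (a + K)) S f
  rw [inter_comm] at h5
  linarith

/-- The average over a later block is at most the average over the block before it, since `f (a +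
A)` lies between them; cleared of denominators, so that empty blocks are allowed. -/
theorem Antitone.mul_sum_Ico_le {f : ℕ → ℝ} (hf : Antitone f) (a A B : ℕ) :
    A * ∑ p ∈ Ico (a + A) (a + A + B), f p ≤ B * ∑ p ∈ Ico a (a + A), f p := by
  have h1 : ∑ p ∈ Ico (a + A) (a + A + B), f p ≤ #(Ico (a + A) (a + A + B)) • f (a + A) :=
    sum_le_card_nsmul _ _ _ fun p hp => hf (mem_Ico.1 hp).1
  have h2 : #(Ico a (a + A)) • f (a + A) ≤ ∑ p ∈ Ico a (a + A), f p :=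
    card_nsmul_le_sum _ _ _ fun p hp => hf (mem_Ico.1 hp).2.le
  rw [Nat.card_Ico, nsmul_eq_mul, Nat.add_sub_cancel_left] at h1 h2
  have h3 := mul_le_mul_of_nonneg_left h1 (Nat.cast_nonneg (α := ℝ) A)
  have h4 := mul_le_mul_of_nonneg_left h2 (Nat.cast_nonneg (α := ℝ) B)
  linarith

/-- The `M` bottom layers of `M + 1` layers without the lowest one are of at least average value. -/
theorem SortedValues.mul_total_succ_le (hw : SortedValues m c w) (hc : ∀ g < m, c g < ℓ)
    (lo : ℕ → ℕ) (M : ℕ) :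
    M * total m c k lo (M + 1) w ≤ (M + 1) * total m c k lo M w := by
  rw [total_eq_sum_slotValue hc, total_eq_sum_slotValue hc, mul_sum, mul_sum]
  refine sum_le_sum fun h _ => ?_
  rw [Nat.succ_mul, ← add_assoc, ← sum_Ico_consecutive _ (Nat.le_add_right (lo h) (M * k h))
    (Nat.le_add_right _ (k h))]
  have h1 := (hw.antitone_slotValue h).mul_sum_Ico_le (lo h) (M * k h) (k h)
  have h2 : 0 ≤ ∑ p ∈ Ico (lo h) (lo h + M * k h), slotValue m c w h p :=
    sum_nonneg fun p _ => hw.slotValue_nonneg h p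
  -- The block inequality `h1` carries the factor `k h`, which has to be cancelled.
  rcases Nat.eq_zero_or_pos (k h) with hk | hk
  · simp [hk]
  · have hk' : (0 : ℝ) < k h := by exact_mod_cast hk
    have h3 : M * ∑ p ∈ Ico (lo h + M * k h) (lo h + M * k h + k h), slotValue m c w h p ≤
        ∑ p ∈ Ico (lo h) (lo h + M * k h), slotValue m c w h p := by
      refine le_of_mul_le_mul_left ?_ hk'
      push_cast at h1
      linarith
    linarith

/-- The `M` layers below the highest one of `M + 1` layers are of at most average value. -/
theorem SortedValues.mul_total_add_le (hw : SortedValues m c w) (hc : ∀ g < m, c g < ℓ)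
    (lo : ℕ → ℕ) (M : ℕ) :
    (M + 1) * total m c k (fun h => lo h + k h) M w ≤ M * total m c k lo (M + 1) w := by
  rw [total_eq_sum_slotValue hc, total_eq_sum_slotValue hc, mul_sum, mul_sum]
  refine sum_le_sum fun h _ => ?_
  rw [Nat.succ_mul, add_comm (M * k h), ← add_assoc,
    ← sum_Ico_consecutive _ (Nat.le_add_right (lo h) (k h)) (Nat.le_add_right _ (M * k h))]
  have h1 := (hw.antitone_slotValue h).mul_sum_Ico_le (lo h) (k h) (M * k h)
  rcases Nat.eq_zero_or_pos (k h) with hk | hk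
  · simp [hk]
  · have hk' : (0 : ℝ) < k h := by exact_mod_cast hk
    have h3 : ∑ p ∈ Ico (lo h + k h) (lo h + k h + M * k h), slotValue m c w h p ≤
        M * ∑ p ∈ Ico (lo h) (lo h + k h), slotValue m c w h p := by
      refine le_of_mul_le_mul_left ?_ hk'
      push_cast at h1
      linarith
    linarith

theorem SortedValues.total_le_add (hw : SortedValues m c w) {lo lo' : ℕ → ℕ} {M g : ℕ}
    (hg : g < m) (h : ∀ b < m, b ≠ g → Alive c k lo M b → Alive c k lo' M b) :
    total m c k lo M w ≤ total m c k lo' M w + w g := by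
  unfold total
  rw [← sum_filter_add_sum_filter_not ((range m).filter (Alive c k lo M)) (· ≠ g)]
  refine add_le_add (sum_le_sum_of_subset_of_nonneg ?_ ?_)
    ((sum_le_sum_of_subset_of_nonneg (t := {g}) ?_ ?_).trans_eq (sum_singleton _ _))
  · intro b
    simp only [mem_filter, mem_range]
    exact fun hb => ⟨hb.1.1, h b hb.1.1 hb.2 hb.1.2⟩
  · intro b hb _
    exact hw.nonneg b (by simp at hb; exact hb.1)
  · intro b
    simp
  · intro b hb _
    rw [mem_singleton.1 hb]
    exact hw.nonneg g hg

theorem SortedValues.total_mono (hw : SortedValues m c w) {lo lo' : ℕ → ℕ} {M M' : ℕ}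
    (h : ∀ b < m, Alive c k lo M b → Alive c k lo' M' b) :
    total m c k lo M w ≤ total m c k lo' M' w := by
  refine sum_le_sum_of_subset_of_nonneg ?_ ?_
  · intro b
    simp only [mem_filter, mem_range]
    exact fun hb => ⟨hb.1, h b hb.1 hb.2⟩
  · intro b hb _
    exact hw.nonneg b (by simp at hb; exact hb.1)

/-- If `a` is a feasible allocation with bundles of value at least `x`, then `n - r` bundles avoid
`r` goods of highest value in their categories. -/
theorem SortedValues.mul_le_total {n r : ℕ} {v : ℕ → ℝ} {σ lo a : ℕ → ℕ} {x : ℝ}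
    (hw : SortedValues m c fun g => v (σ g)) (hc : ∀ g < m, c g < ℓ)
    (hσ : ∀ g < m, σ g < m) (hσc : ∀ g < m, c (σ g) = c g) (hσi : Set.InjOn σ (range m))
    (hcap : ∀ i < n, ∀ h < ℓ, #{g ∈ range m | a g = i ∧ c g = h} ≤ k h)
    (hx : ∀ i < n, x ≤ ∑ g ∈ range m with a g = i, v g)
    (hr : ∑ h ∈ range ℓ, lo h = r) :
    (n - r : ℕ) * x ≤ total m c k lo (n - r) fun g => v (σ g) := by
  -- The slots already removed at the top; there are at most `lo h` of them in category `h`, hence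
  -- at most `r` in all.
  set T := {g ∈ range m | offset c g < lo (c g)} with hT
  have hTcard : #T ≤ r := by
    rw [← hr, card_eq_sum_card_fiberwise (f := c) (t := range ℓ)]
    · refine sum_le_sum fun h _ => ?_
      rw [← card_range (lo h)]
      refine card_le_card_of_injOn (offset c) ?_ ?_
      · intro g hg
        simp only [hT, coe_filter, mem_filter, mem_range, Set.mem_ofPred_eq] at hg
        simpa [← hg.2] using hg.1.2
      · intro g hg g' hg' h'
        simp only [hT, coe_filter, mem_filter, Set.mem_ofPred_eq] at hg hg'
        exact eq_of_offset_eq (hg.2.trans hg'.2.symm) h'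
    · intro g hg
      simp only [hT, coe_filter, mem_range, Set.mem_ofPred_eq] at hg
      simpa using hc g hg.1
  -- Each of the at most `r` goods `σ g` with `g ∈ T` spoils one bundle. Exactly `n - r` of the
  -- unspoiled bundles form `J`.
  have hJcard : n - r ≤ #(range n \ T.image fun g => a (σ g)) := by
    have h1 := le_card_sdiff (T.image fun g => a (σ g)) (range n)
    have h2 := card_image_le (s := T) (f := fun g => a (σ g))
    rw [card_range] at h1
    omega
  obtain ⟨J, hJ, hJn⟩ := exists_subset_card_eq hJcard
  have hJlt : ∀ j ∈ J, j < n := fun j hj => by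
    have := hJ hj
    simp only [mem_sdiff, mem_range] at this
    exact this.1
  have himage : (range m).image σ = range m := by
    refine eq_of_subset_of_card_le ?_ (card_image_of_injOn hσi).ge
    intro g hg
    obtain ⟨b, hb, rfl⟩ := mem_image.1 hg
    exact mem_range.2 (hσ b (mem_range.1 hb))
  calc ((n - r : ℕ) : ℝ) * x = ∑ j ∈ J, x := by rw [sum_const, hJn, nsmul_eq_mul]
    _ ≤ ∑ j ∈ J, ∑ g ∈ range m with a g = j, v g := sum_le_sum fun j hj => hx j (hJlt j hj)
    _ = ∑ g ∈ range m with a g ∈ J, v g := by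
        rw [← sum_fiberwise_of_maps_to (s := {g ∈ range m | a g ∈ J}) (t := J) (g := a)]
        · refine sum_congr rfl fun j hj => sum_congr ?_ fun _ _ => rfl
          ext g
          simp only [mem_filter]
          exact ⟨fun h => ⟨⟨h.1, h.2 ▸ hj⟩, h.2⟩, fun h => ⟨h.1.1, h.2⟩⟩
        · exact fun g hg => (mem_filter.1 hg).2
    _ = ∑ g ∈ range m with a (σ g) ∈ J, v (σ g) := by
        rw [sum_filter, ← himage, sum_image hσi, himage, sum_filter]
    _ = ∑ h ∈ range ℓ, ∑ g ∈ range m with a (σ g) ∈ J ∧ c g = h, v (σ g) := by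
        rw [← sum_fiberwise_of_maps_to (t := range ℓ) (g := c)]
        · simp only [filter_filter]
        · intro g hg
          simp only [mem_filter, mem_range] at hg ⊢
          exact hc g hg.1
    _ ≤ ∑ h ∈ range ℓ, ∑ p ∈ Ico (lo h) (lo h + (n - r) * k h),
          slotValue m c (fun g => v (σ g)) h p := by
        refine sum_le_sum fun h hh => ?_
        have hinj : Set.InjOn (offset c)
            ({g ∈ range m | a (σ g) ∈ J ∧ c g = h} : Finset ℕ) := by
          intro g hg g' hg' h'
          simp only [coe_filter, Set.mem_ofPred_eq] at hg hg'
          exact eq_of_offset_eq (hg.2.2.trans hg'.2.2.symm) h'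
        have hsum : ∑ g ∈ range m with a (σ g) ∈ J ∧ c g = h, v (σ g) =
            ∑ p ∈ {g ∈ range m | a (σ g) ∈ J ∧ c g = h}.image (offset c),
              slotValue m c (fun g => v (σ g)) h p := by
          rw [sum_image hinj]
          refine sum_congr rfl fun g hg => ?_
          simp only [mem_filter, mem_range] at hg
          rw [← hg.2.2, slotValue_eq hg.1]
        rw [hsum]
        -- In category `h`, the slots used by `J` start at `lo h` because `J` avoids `T`, and their
        -- number is at most `(n - r) * k h` because each bundle respects the threshold.
        refine (hw.antitone_slotValue h).sum_le_sum_Ico (hw.slotValue_nonneg h) ?_ ?_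
        · intro p hp
          obtain ⟨g, hg, rfl⟩ := mem_image.1 hp
          simp only [mem_filter, mem_range] at hg
          by_contra hlt
          have hgJ := hJ hg.2.1
          simp only [mem_sdiff, mem_image, not_exists, not_and] at hgJ
          refine hgJ.2 g ?_ rfl
          simp only [hT, mem_filter, mem_range]
          exact ⟨hg.1, by rw [hg.2.2]; omega⟩
        · refine card_image_le.trans ?_
          rw [card_eq_sum_card_fiberwise (f := fun g => a (σ g)) (t := J)]
          · rw [← hJn, ← smul_eq_mul]
            refine sum_le_card_nsmul _ _ _ fun j hj => ?_
            refine le_trans ?_ (hcap j (hJlt j hj) h (mem_range.1 hh))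
            refine card_le_card_of_injOn σ ?_ ?_
            · intro g hg
              simp only [coe_filter, mem_filter, mem_range, Set.mem_ofPred_eq] at hg ⊢
              exact ⟨hσ g hg.1.1, hg.2, (hσc g hg.1.1).trans hg.1.2.2⟩
            · refine hσi.mono fun g hg => ?_
              simp only [coe_filter, mem_filter, Set.mem_ofPred_eq] at hg
              exact hg.1.1
          · intro g hg
            simp only [coe_filter, Set.mem_ofPred_eq] at hg
            exact hg.2.1
    _ = _ := (total_eq_sum_slotValue hc lo (n - r)).symm

end Slots

/-! ### Identically ordered instances and the invariant of the bag filling -/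

section Slots

open Finset

/-- An instance with categories `c` and thresholds `k` in which every agent `i` has sorted the goods
inside each category by a permutation `σ i`, together with upper bounds `share i` for the
constrained maximin shares. -/
structure OrderedInstance (m n ℓ : ℕ) where
  c : ℕ → ℕ
  k : ℕ → ℕ
  v : ℕ → ℕ → ℝ
  σ : ℕ → ℕ → ℕ
  share : ℕ → ℝ
  c_lt : ∀ g < m, c g < ℓ
  offset_lt : ∀ g < m, offset c g < n * k (c g)
  σ_lt : ∀ i < n, ∀ g < m, σ i g < m
  c_σ : ∀ i < n, ∀ g < m, c (σ i g) = c g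
  σ_inj : ∀ i < n, Set.InjOn (σ i) (range m)
  sorted : ∀ i < n, SortedValues m c fun g => v i (σ i g)
  -- The only property of the shares that is needed: giving away `r` top slots, one per bundle, does
  -- not push the average below the share. It is supplied by `SortedValues.mul_le_total`.
  share_le : ∀ i < n, ∀ (lo : ℕ → ℕ) (r : ℕ), ∑ h ∈ range ℓ, lo h = r →
    (n - r : ℕ) * share i ≤ total m c k lo (n - r) fun g => v i (σ i g)

namespace OrderedInstance

variable {m n ℓ : ℕ} (O : OrderedInstance m n ℓ)

/-- The value that the agent `i` assigns to the slot `g`. -/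
def w (i g : ℕ) : ℝ := O.v i (O.σ i g)

/-- The alive slots. -/
def Live (lo : ℕ → ℕ) (M g : ℕ) : Prop := Alive O.c O.k lo M g

instance (lo : ℕ → ℕ) (M : ℕ) : DecidablePred (O.Live lo M) :=
  inferInstanceAs (DecidablePred (Alive O.c O.k lo M))

/-- The value of the alive slots for the agent `i`. -/
noncomputable def tot (i : ℕ) (lo : ℕ → ℕ) (M : ℕ) : ℝ := total m O.c O.k lo M (O.w i)

/-- After `r` bundles have been given away, every remaining agent can expect her share on average,
and no slot has more than a third of the average value. -/
def Normal (r : ℕ) (lo sat : ℕ → ℕ) : Prop :=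
  ∀ i < n, sat i = 0 → (n - r : ℕ) * O.share i ≤ O.tot i lo (n - r) ∧
    ∀ g < m, O.Live lo (n - r) g → 3 * (n - r : ℕ) * O.w i g ≤ O.tot i lo (n - r)

/-- In phase `0`, only bundles around a single top slot have been given away; in the other phases,
the state is normal. -/
def Phase (q r : ℕ) (lo sat : ℕ → ℕ) : Prop :=
  q = 0 ∧ ∑ h ∈ range ℓ, lo h = r ∨ q ≠ 0 ∧ O.Normal r lo sat

/-- The agent `i` is content with the slots that are alive, but no longer after the removal of `t`
top slots. -/
def Accepts (r : ℕ) (lo t : ℕ → ℕ) (i : ℕ) : Prop :=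
  -- The bundle is compared with a third of the current average rather than of the share. The
  -- program can evaluate this without knowing the share, and it is the stronger demand whenever the
  -- average is at least the share.
  O.tot i lo (n - r) ≤
    3 * (n - r : ℕ) * (O.tot i lo (n - r) - O.tot i (fun h => lo h + t h) (n - (r + 1)))

/-- The slots that are not alive have been given by `own` to `r` agents who are satisfied. -/
structure Progress (q r : ℕ) (lo own sat : ℕ → ℕ) : Prop where
  card : #{i ∈ range n | sat i = 0} + r = n
  own_lt : ∀ g < m, ¬ O.Live lo (n - r) g → own g < n
  sat_own : ∀ g < m, ¬ O.Live lo (n - r) g → sat (own g) ≠ 0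
  cap : ∀ i < n, ∀ h < ℓ, #{g ∈ range m | ¬ O.Live lo (n - r) g ∧ own g = i ∧ O.c g = h} ≤ O.k h
  val : ∀ i < n, sat i ≠ 0 →
    O.share i ≤ 3 * ∑ g ∈ range m with ¬ O.Live lo (n - r) g ∧ own g = i, O.w i g
  phase : O.Phase q r lo sat

variable {O}

theorem tot_nonneg {i : ℕ} (hi : i < n) (lo : ℕ → ℕ) (M : ℕ) : 0 ≤ O.tot i lo M :=
  sum_nonneg fun g hg => (O.sorted i hi).nonneg g (mem_range.1 (mem_filter.1 hg).1)

/-- The window that starts `t ≤ k` offsets later and is `k` shorter lies inside the old one. -/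
theorem Live.of_succ {lo t : ℕ → ℕ} {M g : ℕ} (ht : t (O.c g) ≤ O.k (O.c g))
    (h : O.Live (fun h => lo h + t h) M g) : O.Live lo (M + 1) g := by
  obtain ⟨h1, h2⟩ := h
  dsimp only at h1 h2
  refine ⟨by omega, ?_⟩
  rw [Nat.succ_mul]
  omega

theorem Phase.mul_share_le {q r : ℕ} {lo sat : ℕ → ℕ} (h : O.Phase q r lo sat) {i : ℕ} (hi : i < n)
    (hs : sat i = 0) : (n - r : ℕ) * O.share i ≤ O.tot i lo (n - r) := by
  rcases h with ⟨-, h⟩ | ⟨-, h⟩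
  · exact O.share_le i hi lo r h
  · exact (h i hi hs).1

/-- Both clauses bound something by the average, and `hle` says that the average does not fall. -/
theorem Normal.of_le {r M : ℕ} {lo lo' sat : ℕ → ℕ} (h : O.Normal r lo sat) (hr : n - r = M + 1)
    (hsub : ∀ g < m, O.Live lo' M g → O.Live lo (M + 1) g)
    (hle : ∀ i < n, sat i = 0 → M * O.tot i lo (M + 1) ≤ (M + 1) * O.tot i lo' M) :
    O.Normal (r + 1) lo' sat := by
  intro i hi hs
  obtain ⟨h1, h2⟩ := h i hi hs
  have h3 := hle i hi hs
  have hr' : n - (r + 1) = M := by omega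
  rw [hr] at h1 h2
  rw [hr']
  push_cast at h1 h2
  have hM : (0 : ℝ) ≤ M := Nat.cast_nonneg M
  have hM' : (0 : ℝ) < M + 1 := by linarith
  constructor
  · refine le_of_mul_le_mul_left ?_ hM'
    refine le_trans ?_ h3
    have := mul_le_mul_of_nonneg_left h1 hM
    linarith
  · intro g hg hl
    refine le_of_mul_le_mul_left ?_ hM'
    refine le_trans ?_ h3
    have := mul_le_mul_of_nonneg_left (h2 g hg (hsub g hg hl)) hM
    linarith

/-- The bottom layer is worth at most the average, whether or not anybody rejected something before.
-/
theorem Normal.zero {r M : ℕ} {lo sat : ℕ → ℕ} (h : O.Normal r lo sat) (hr : n - r = M + 1) :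
    O.Normal (r + 1) (fun h => lo h + 0) sat :=
  h.of_le hr (fun _ _ hl => Live.of_succ (t := fun _ => 0) (Nat.zero_le _) hl) fun i hi _ =>
    (O.sorted i hi).mul_total_succ_le O.c_lt lo M

/-- The removal of one more slot costs little. -/
theorem Normal.succ {r M g : ℕ} {lo t t' sat : ℕ → ℕ} (h : O.Normal r lo sat)
    (hr : n - r = M + 1) (hg : g < m) (ht : ∀ h < ℓ, t h ≤ O.k h)
    (hgt : offset O.c g = lo (O.c g) + t (O.c g)) (hgk : t (O.c g) < O.k (O.c g))
    (ht' : ∀ h, t' h = if h = O.c g then t h + 1 else t h)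
    (hrej : ∀ i < n, sat i = 0 → ¬ O.Accepts r lo t i) :
    O.Normal (r + 1) (fun h => lo h + t' h) sat := by
  have ht'k : ∀ h < ℓ, t' h ≤ O.k h := fun h hh => by
    rw [ht']
    split_ifs with hc
    · rw [hc]
      omega
    · exact ht h hh
  refine h.of_le hr (fun b hb hl => Live.of_succ (ht'k _ (O.c_lt b hb)) hl) fun i hi hs => ?_
  -- The window for `t'` is the one for `t` shifted by one offset in the category of `g`: it loses
  -- `g` and regains a slot at the bottom. So the bundle grows in value by at most `O.w i g`.
  have h1 : O.tot i (fun h => lo h + t h) M ≤ O.tot i (fun h => lo h + t' h) M + O.w i g := by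
    refine (O.sorted i hi).total_le_add hg fun b hb hbg hl => ?_
    obtain ⟨h1, h2⟩ := hl
    have hne : O.c b = O.c g → offset O.c b ≠ offset O.c g := fun hc ho =>
      hbg (eq_of_offset_eq hc ho)
    unfold Alive
    simp only [ht'] at h1 h2 ⊢
    split_ifs with hc
    · have := hne hc
      rw [hc] at h1 h2 ⊢
      omega
    · omega
  have h2 := hrej i hi hs
  have h3 := (h i hi hs).2 g hg ⟨by omega, by
    rw [hr, Nat.succ_mul]
    omega⟩
  have hr' : n - (r + 1) = M := by omega
  unfold Accepts at h2
  rw [hr, hr'] at h2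
  rw [hr] at h3
  push_cast at h2 h3
  -- The rejected bundle is worth less than a third of the average (`h2`) and the new slot at most a
  -- third (`h3`); two thirds do not exceed the whole because the total is nonnegative (`h5`).
  have h4 := mul_le_mul_of_nonneg_left h1 (by positivity : (0 : ℝ) ≤ 3 * (M + 1))
  have h5 := tot_nonneg (O := O) hi lo (M + 1)
  linarith

/-- If nobody accepts a single top slot together with the lowest slots, then all slots are small. -/
theorem Phase.normal {q r M : ℕ} {lo sat : ℕ → ℕ} (h : O.Phase q r lo sat) (hr : n - r = M + 1)
    (hrej : ∀ g < m, offset O.c g = lo (O.c g) → 0 < O.k (O.c g) → ∀ i < n, sat i = 0 →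
      ¬ O.Accepts r lo (fun h => if h = O.c g then 1 else 0) i) :
    O.Normal r lo sat := by
  intro i hi hs
  refine ⟨h.mul_share_le hi hs, fun g hg hl => ?_⟩
  obtain ⟨hl1, hl2⟩ := hl
  have hk : 0 < O.k (O.c g) := by
    by_contra h0
    rw [Nat.eq_zero_of_not_pos h0] at hl2
    omega
  -- The slot `b` is the first alive one in the category of `g`. It is worth at least as much as
  -- `g`, and the rejected bundle around `b` is worth at least as much as `b`.
  obtain ⟨b, hb, hbc, hbo, hbw⟩ : ∃ b < m, O.c b = O.c g ∧ offset O.c b = lo (O.c g) ∧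
      O.w i g ≤ O.w i b := by
    rcases hl1.eq_or_lt with h' | h'
    · exact ⟨g, hg, rfl, h'.symm, le_rfl⟩
    · obtain ⟨b, hb, hbc, hbo⟩ := exists_offset_eq_of_lt h'
      exact ⟨b, hb.trans hg, hbc, hbo, (O.sorted i hi).anti b g hb hg hbc⟩
  have h1 := hrej b hb (by rw [hbo, hbc]) (by rwa [hbc]) i hi hs
  have hr' : n - (r + 1) = M := by omega
  unfold Accepts at h1
  rw [hr, hr'] at h1
  rw [hr]
  push_cast at h1 ⊢
  have h2 : O.w i b + O.tot i (fun h => lo h + if h = O.c b then 1 else 0) M ≤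
      O.tot i lo (M + 1) := by
    unfold tot total
    rw [← sum_insert (f := O.w i)]
    · refine sum_le_sum_of_subset_of_nonneg ?_ ?_
      · intro x hx
        simp only [mem_insert, mem_filter, mem_range] at hx ⊢
        rcases hx with rfl | ⟨hx, hx'⟩
        · refine ⟨hb, by rw [hbo, hbc], ?_⟩
          rw [hbo, hbc, Nat.succ_mul]
          omega
        · refine ⟨hx, Live.of_succ (O := O) (t := fun h => if h = O.c b then 1 else 0) ?_ hx'⟩
          split_ifs with hc
          · rw [hc, hbc]
            exact hk
          · exact Nat.zero_le _
      · intro x hx _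
        simp only [mem_filter, mem_range] at hx
        exact (O.sorted i hi).nonneg x hx.1
    · intro hb'
      obtain ⟨h', -⟩ := (mem_filter.1 hb').2
      dsimp only at h'
      rw [if_pos rfl, hbo, hbc] at h'
      omega
  have h3 := mul_le_mul_of_nonneg_left h2 (by positivity : (0 : ℝ) ≤ 3 * (M + 1))
  have h4 := mul_le_mul_of_nonneg_left hbw (by positivity : (0 : ℝ) ≤ 3 * (M + 1))
  linarith

/-- All agents accept the top layer. -/
theorem accepts_of_forall {r M i : ℕ} {lo t : ℕ → ℕ} (hr : n - r = M + 1) (hi : i < n)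
    (ht : ∀ h < ℓ, t h ≤ O.k h)
    (h : ∀ g < m, offset O.c g < lo (O.c g) + t (O.c g) ∨
      lo (O.c g) + O.k (O.c g) ≤ offset O.c g) :
    O.Accepts r lo t i := by
  -- Here `t` may stay below `k` where a category has run out of goods. By `h`, the offsets between
  -- `lo + t` and `lo + k` carry no goods, so nothing is lost against the full top layer.
  have h1 : O.tot i (fun h => lo h + t h) M ≤ O.tot i (fun h => lo h + O.k h) M := by
    refine (O.sorted i hi).total_mono fun b hb hl => ?_
    obtain ⟨h1, h2⟩ := hl
    have h3 := ht _ (O.c_lt b hb)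
    have h4 := h b hb
    dsimp only at h1 h2
    constructor <;> dsimp only <;> omega
  have h2 := (O.sorted i hi).mul_total_add_le (k := O.k) O.c_lt lo M
  have h5 : 0 ≤ O.tot i lo (M + 1) := tot_nonneg hi lo (M + 1)
  have hr' : n - (r + 1) = M := by omega
  unfold Accepts
  rw [hr, hr']
  push_cast
  have h3 := mul_le_mul_of_nonneg_left h1 (by positivity : (0 : ℝ) ≤ M + 1)
  unfold tot w at *
  linarith

theorem Progress.zero {lo own sat : ℕ → ℕ} (hlo : ∀ h, lo h = 0) (hs : ∀ i, sat i = 0) :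
    O.Progress 0 0 lo own sat := by
  have hlive : ∀ g < m, O.Live lo (n - 0) g := fun g hg =>
    ⟨by simp [hlo], by simpa [hlo] using O.offset_lt g hg⟩
  refine ⟨by simp [hs], fun g hg h => absurd (hlive g hg) h, fun g hg h => absurd (hlive g hg) h,
    fun i _ h _ => ?_, fun i _ h => absurd (hs i) h, Or.inl ⟨rfl, by simp [hlo]⟩⟩
  rw [filter_eq_empty_iff.2, card_empty]
  · exact Nat.zero_le _
  · exact fun g hg h' => h'.1 (hlive g (mem_range.1 hg))

/-- One more bundle is given away. -/
theorem Progress.succ {q q' r i : ℕ} {lo lo' own own' sat sat' t : ℕ → ℕ}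
    (h : O.Progress q r lo own sat) (hi : i < n) (hs : sat i = 0)
    (ht : ∀ h < ℓ, t h ≤ O.k h) (hacc : O.Accepts r lo t i)
    (hlo : ∀ h < ℓ, lo' h = lo h + t h)
    (hown : ∀ g < m, own' g = if O.Live lo (n - r) g ∧
      ¬ O.Live (fun h => lo h + t h) (n - (r + 1)) g then i else own g)
    (hsat : ∀ j, sat' j = if j = i then 1 else sat j)
    (hph : O.Phase q' (r + 1) (fun h => lo h + t h) sat) :
    O.Progress q' (r + 1) lo' own' sat' := by
  -- Agent `i` is still unsatisfied, so `r < n` and the subtraction is not truncated.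
  have hn : n - r = n - (r + 1) + 1 := by
    have h1 := h.card
    have h2 : 0 < #{i ∈ range n | sat i = 0} :=
      card_pos.2 ⟨i, mem_filter.2 ⟨mem_range.2 hi, hs⟩⟩
    omega
  generalize hM : n - (r + 1) = M at *
  have hlive' : ∀ g < m, (O.Live lo' M g ↔ O.Live (fun h => lo h + t h) M g) := fun g hg => by
    unfold Live Alive
    rw [hlo _ (O.c_lt g hg)]
  have hsub : ∀ g < m, O.Live lo' M g → O.Live lo (n - r) g := fun g hg hl => by
    rw [hn]
    exact Live.of_succ (ht _ (O.c_lt g hg)) ((hlive' g hg).1 hl)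
  have hown' : ∀ g < m, own' g = if O.Live lo (n - r) g ∧ ¬ O.Live lo' M g then i else own g :=
    fun g hg => by rw [hown g hg]; simp only [hlive' g hg]
  have hsum : ∀ S : Finset ℕ, (S ⊆ range m) → ∀ j < n, 0 ≤ ∑ g ∈ S, O.w j g := fun S hS j hj =>
    sum_nonneg fun g hg => (O.sorted j hj).nonneg g (mem_range.1 (hS hg))
  constructor
  · have : ({j ∈ range n | sat j = 0} : Finset ℕ) = insert i {j ∈ range n | sat' j = 0} := by
      ext j
      simp only [mem_insert, mem_filter, mem_range, hsat]
      constructor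
      · rintro ⟨h1, h2⟩
        by_cases hji : j = i
        · exact Or.inl hji
        · exact Or.inr ⟨h1, by rwa [if_neg hji]⟩
      · rintro (rfl | ⟨h1, h2⟩)
        · exact ⟨hi, hs⟩
        · by_cases hji : j = i
          · simp [hji] at h2
          · exact ⟨h1, by rwa [if_neg hji] at h2⟩
    have h1 := h.card
    rw [this, card_insert_of_notMem (by simp [hsat])] at h1
    omega
  · intro g hg hl
    rw [hM] at hl
    rw [hown' g hg]
    split_ifs with h'
    · exact hi
    · exact h.own_lt g hg fun h1 => h' ⟨h1, hl⟩
  · intro g hg hl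
    rw [hM] at hl
    rw [hown' g hg]
    split_ifs with h'
    · simp [hsat]
    · rw [hsat]
      split_ifs
      · exact one_ne_zero
      · exact h.sat_own g hg fun h1 => h' ⟨h1, hl⟩
  · intro j hj h₀ hh₀
    rw [hM]
    by_cases hji : j = i
    · subst hji
      -- Agent `i` owned nothing before (`sat_own`), so she has just the removed offsets: `t h₀` at
      -- the top and `k h₀ - t h₀` at the bottom, `k h₀` in total.
      have hcard : #(Ico (lo h₀) (lo h₀ + t h₀) ∪
          Ico (lo h₀ + t h₀ + M * O.k h₀) (lo h₀ + (M + 1) * O.k h₀)) ≤ O.k h₀ := by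
        refine (card_union_le _ _).trans ?_
        have := ht h₀ hh₀
        rw [Nat.card_Ico, Nat.card_Ico, Nat.succ_mul]
        omega
      refine le_trans (card_le_card_of_injOn (offset O.c) ?_ ?_) hcard
      · intro g hg
        simp only [coe_filter, mem_range, Set.mem_ofPred_eq] at hg
        obtain ⟨hg, hl, hj', hc⟩ := hg
        have hl1 : O.Live lo (n - r) g := by
          by_contra hl1
          rw [hown' g hg, if_neg fun h' => hl1 h'.1] at hj'
          exact h.sat_own g hg hl1 (hj' ▸ hs)
        rw [hlive' g hg] at hl
        rw [hn] at hl1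
        obtain ⟨h1, h2⟩ := hl1
        unfold Live Alive at hl
        dsimp only at hl
        rw [hc] at h1 h2 hl
        simp only [coe_union, coe_Ico, Set.mem_union, Set.mem_Ico, Nat.succ_mul] at h2 ⊢
        omega
      · intro g hg g' hg' ho
        simp only [coe_filter, Set.mem_ofPred_eq] at hg hg'
        exact eq_of_offset_eq (hg.2.2.2.trans hg'.2.2.2.symm) ho
    · refine le_trans (card_le_card ?_) (h.cap j hj h₀ hh₀)
      intro g hg
      simp only [mem_filter, mem_range] at hg ⊢
      obtain ⟨hg, hl, hj', hc⟩ := hg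
      rw [hown' g hg] at hj'
      split_ifs at hj' with h'
      · exact absurd hj'.symm hji
      · exact ⟨hg, fun h1 => h' ⟨h1, hl⟩, hj', hc⟩
  · intro j hj hsj
    rw [hM]
    by_cases hji : j = i
    · subst hji
      have hshare := h.phase.mul_share_le hi hs
      have hbag : O.tot j lo (n - r) - O.tot j (fun h => lo h + t h) M ≤
          ∑ g ∈ range m with ¬ O.Live lo' M g ∧ own' g = j, O.w j g := by
        rw [sub_le_iff_le_add]
        unfold tot total
        rw [← sum_union]
        · refine sum_le_sum_of_subset_of_nonneg ?_ ?_
          · intro g hg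
            simp only [mem_filter, mem_range, mem_union] at hg ⊢
            by_cases hl : O.Live lo' M g
            · exact Or.inr ⟨hg.1, (hlive' g hg.1).1 hl⟩
            · refine Or.inl ⟨hg.1, hl, ?_⟩
              rw [hown' g hg.1, if_pos ⟨hg.2, hl⟩]
          · intro g hg _
            simp only [mem_filter, mem_range, mem_union] at hg
            exact (O.sorted j hj).nonneg g (by tauto)
        · rw [disjoint_left]
          intro g hg hg'
          simp only [mem_filter, mem_range] at hg hg'
          exact hg.2.1 ((hlive' g hg.1).2 hg'.2)
      unfold Accepts at hacc
      rw [hM] at hacc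
      have hpos : (0 : ℝ) < (n - r : ℕ) := by exact_mod_cast (by omega : 0 < n - r)
      refine le_of_mul_le_mul_left ?_ hpos
      have := mul_le_mul_of_nonneg_left hbag (by positivity : (0 : ℝ) ≤ 3 * (n - r : ℕ))
      linarith
    · rw [hsat, if_neg hji] at hsj
      refine (h.val j hj hsj).trans ?_
      refine mul_le_mul_of_nonneg_left ?_ (by norm_num)
      refine sum_le_sum_of_subset_of_nonneg ?_ ?_
      · intro g hg
        simp only [mem_filter, mem_range] at hg ⊢
        obtain ⟨hg, hl, hj'⟩ := hg
        exact ⟨hg, fun h' => hl (hsub g hg h'), by rw [hown' g hg, if_neg fun h' => hl h'.1, hj']⟩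
      · intro g hg _
        simp only [mem_filter, mem_range] at hg
        exact (O.sorted j hj).nonneg g hg.1
  · rcases hph with ⟨hq, hph⟩ | ⟨hq, hph⟩
    · refine Or.inl ⟨hq, ?_⟩
      rw [← hph]
      exact sum_congr rfl fun h hh => hlo h (mem_range.1 hh)
    · refine Or.inr ⟨hq, ?_⟩
      intro j hj hsj
      have hsj' : sat j = 0 := by
        rw [hsat] at hsj
        split_ifs at hsj
        exact hsj
      have htot : O.tot j lo' M = O.tot j (fun h => lo h + t h) M := by
        unfold tot total
        exact sum_congr (filter_congr fun g hg => hlive' g (mem_range.1 hg)) fun _ _ => rfl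
      have := hph j hj hsj'
      rw [hM] at this ⊢
      rw [htot]
      exact ⟨this.1, fun g hg hl => this.2 g hg ((hlive' g hg).1 hl)⟩

end OrderedInstance

end Slots

/-! ### Sorting the goods inside the categories by exchanges -/

section Sorting

open Finset

/-- `τ` is injective on the goods and keeps their categories. -/
structure KeepsCategory (m : ℕ) (c τ : ℕ → ℕ) : Prop where
  lt : ∀ g < m, τ g < m
  cat : ∀ g < m, c (τ g) = c g
  inj : Set.InjOn τ (range m)

theorem KeepsCategory.swap {m : ℕ} {c τ τ' : ℕ → ℕ} (h : KeepsCategory m c τ) {a b : ℕ}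
    (ha : a < m) (hb : b < m) (hc : c a = c b)
    (hτ : ∀ x, τ' x = if x = b then τ a else if x = a then τ b else τ x) :
    KeepsCategory m c τ' := by
  have hτ' : ∀ x, τ' x = τ (Equiv.swap a b x) := fun x => by
    rw [hτ, Equiv.swap_apply_def]
    split_ifs <;> simp_all
  have hlt : ∀ x < m, Equiv.swap a b x < m := fun x hx => by
    rw [Equiv.swap_apply_def]
    split_ifs <;> assumption
  refine ⟨fun g hg => hτ' g ▸ h.lt _ (hlt g hg), fun g hg => ?_, fun x hx y hy hxy => ?_⟩
  · rw [hτ', h.cat _ (hlt g hg), Equiv.swap_apply_def]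
    split_ifs with h1 h2
    · rw [h1, hc]
    · rw [h2, hc]
    · rfl
  · rw [hτ', hτ'] at hxy
    have := h.inj (by simpa using hlt x (by simpa using hx))
      (by simpa using hlt y (by simpa using hy)) hxy
    simpa using this

/-- In the order `τ` the first `a` goods are sorted, and they are followed by goods of at most their
values. -/
def SortedUpTo (m : ℕ) (c : ℕ → ℕ) (v : ℕ → ℝ) (τ : ℕ → ℕ) (a : ℕ) : Prop :=
  ∀ g < a, ∀ g', g < g' → g' < m → c g = c g' → v (τ g') ≤ v (τ g)

/-- Only places from `a` on are permuted, and the first `a` places already dominate all later places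
of their categories. -/
theorem SortedUpTo.swap {m : ℕ} {c τ τ' : ℕ → ℕ} {v : ℕ → ℝ} {a b : ℕ}
    (h : SortedUpTo m c v τ a) (ha : a < m) (hb : b < m) (hab : a < b) (hc : c a = c b)
    (hτ : ∀ x, τ' x = if x = b then τ a else if x = a then τ b else τ x) :
    SortedUpTo m c v τ' a := by
  intro g hg g' hgg' hg' hcg
  rw [hτ, hτ g, if_neg (by omega : g ≠ b), if_neg (by omega : g ≠ a)]
  split_ifs with h1 h2
  · exact h g hg a hg ha (by rw [hcg, h1, hc])
  · exact h g hg b (by omega) hb (by rw [hcg, h2, hc])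
  · exact h g hg g' hgg' hg' hcg

end Sorting

/-! ### Programs for sorting, offsets and capacities -/

namespace RAM

/-- The cell `(0, 0)` of the array `a`. -/
def NExp.scalar (a : ℕ) : NExp := .get a (.const 0) (.const 0)

/-- The cell `(x, 0)` of the array `a`. -/
def NExp.entry (a : ℕ) (x : NExp) : NExp := .get a x (.const 0)

@[simp] theorem NExp.eval_scalar (s : Mem) (a : ℕ) : (NExp.scalar a).eval s = s.nat a 0 0 := rfl

@[simp] theorem NExp.eval_entry (s : Mem) (a : ℕ) (x : NExp) :
    (NExp.entry a x).eval s = s.nat a (x.eval s) 0 := rfl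

@[simp] theorem NExp.eval_const (s : Mem) (x : ℕ) : (NExp.const x).eval s = x := rfl

@[simp] theorem NExp.eval_get (s : Mem) (a : ℕ) (x y : NExp) :
    (NExp.get a x y).eval s = s.nat a (x.eval s) (y.eval s) := rfl

@[simp] theorem NExp.eval_add (s : Mem) (x y : NExp) :
    (NExp.add x y).eval s = x.eval s + y.eval s := rfl

@[simp] theorem NExp.eval_sub (s : Mem) (x y : NExp) :
    (NExp.sub x y).eval s = x.eval s - y.eval s := rfl

@[simp] theorem RExp.eval_get (s : Mem) (a : ℕ) (x y : NExp) :
    (RExp.get a x y).eval s = s.real a (x.eval s) (y.eval s) := rfl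

@[simp] theorem RExp.eval_add (s : Mem) (x y : RExp) :
    (RExp.add x y).eval s = x.eval s + y.eval s := rfl

@[simp] theorem RExp.eval_sub (s : Mem) (x y : RExp) :
    (RExp.sub x y).eval s = x.eval s - y.eval s := rfl

@[simp] theorem RExp.eval_zero (s : Mem) : RExp.zero.eval s = 0 := rfl

open Prog

/-- The number of goods. -/
def numGoods : NExp := .get 0 (.const 0) (.const 0)

/-- The number of agents. -/
def numAgents : NExp := .get 0 (.const 1) (.const 0)

/-- The number of categories. -/
def numCats : NExp := .get 0 (.const 2) (.const 0)

@[simp] theorem eval_numGoods (s : Mem) : numGoods.eval s = s.nat 0 0 0 := rfl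

@[simp] theorem eval_numAgents (s : Mem) : numAgents.eval s = s.nat 0 1 0 := rfl

@[simp] theorem eval_numCats (s : Mem) : numCats.eval s = s.nat 0 2 0 := rfl

theorem wp_cond {N : ℕ} {b : Test} {p : Prog} {Q : Mem → Prop} {s : Mem}
    (h : b.Holds s → p.wp N Q s) (h' : ¬ b.Holds s → Q s) : (cond b p).wp N Q s :=
  ⟨h, h'⟩

/-- The value, for the agent in cell `12`, of the good at the place `x` of the agent's order. -/
def sortKey (x : ℕ) : RExp := .get 0 (.scalar 12) (.get 4 (.scalar 12) (.scalar x))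

/-- One comparison of the exchange sort. -/
def exchange : Prog :=
  cond (.and (.ltN (.scalar 13) (.scalar 14))
      (.and (.eqN (.entry 1 (.scalar 13)) (.entry 1 (.scalar 14)))
        (.ltR (sortKey 13) (sortKey 14))))
    (seq (setN 15 (.const 0) (.const 0) (.get 4 (.scalar 12) (.scalar 13)))
      (seq (setN 4 (.scalar 12) (.scalar 13) (.get 4 (.scalar 12) (.scalar 14)))
        (setN 4 (.scalar 12) (.scalar 14) (.scalar 15))))

/-- The row `i` of the array `4` becomes the order of the goods that sorts them inside their
categories by their values for the agent `i`. -/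
def sortGoods : Prog :=
  forLoop 12 numAgents
    (seq (forLoop 13 numGoods (setN 4 (.scalar 12) (.scalar 13) (.scalar 13)))
      (forLoop 13 numGoods (forLoop 14 numGoods exchange)))

/-- Place `a` holds a maximum of its category among the places from `a` to `b - 1`; one comparison
extends this to `b`. -/
theorem wp_exchange {N m i a b : ℕ} {s : Mem} (h12 : s.nat 12 0 0 = i) (h13 : s.nat 13 0 0 = a)
    (h14 : s.nat 14 0 0 = b) (ha : a < m) (hb : b < m)
    (hk : KeepsCategory m (s.nat 1 · 0) (s.nat 4 i))
    (hs : SortedUpTo m (s.nat 1 · 0) (s.real 0 i) (s.nat 4 i) a)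
    (hab : ∀ g, a < g → g < b → s.nat 1 a 0 = s.nat 1 g 0 →
      s.real 0 i (s.nat 4 i g) ≤ s.real 0 i (s.nat 4 i a)) :
    exchange.wp N (fun s' => (∀ j, j ≠ i → s'.nat 4 j = s.nat 4 j) ∧
      KeepsCategory m (s.nat 1 · 0) (s'.nat 4 i) ∧
      SortedUpTo m (s.nat 1 · 0) (s.real 0 i) (s'.nat 4 i) a ∧
      ∀ g, a < g → g < b + 1 → s.nat 1 a 0 = s.nat 1 g 0 →
        s.real 0 i (s'.nat 4 i g) ≤ s.real 0 i (s'.nat 4 i a)) s := by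
  refine wp_cond (fun h => ?_) (fun h => ?_)
  · simp only [Test.Holds, Test.holds_eqN, NExp.eval_scalar, NExp.eval_entry, sortKey,
      RExp.eval_get, NExp.eval_get, h12, h13, h14] at h
    obtain ⟨hlt, hc, hv⟩ := h
    refine wp_mono (Q := fun s' => (∀ j, j ≠ i → s'.nat 4 j = s.nat 4 j) ∧ ∀ x, s'.nat 4 i x =
      if x = b then s.nat 4 i a else if x = a then s.nat 4 i b else s.nat 4 i x) ?_ ?_
    · simp only [wp, NExp.eval_scalar, NExp.eval_get, NExp.eval_const]
      refine ⟨fun j hj => ?_, fun x => ?_⟩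
      · funext x
        simp [update_of_ne, h12, hj]
      · simp [update_of_ne, h12, h13, h14]
    · rintro s' ⟨hother, hrow⟩
      refine ⟨hother, hk.swap ha hb hc hrow, hs.swap ha hb hlt hc hrow, fun g hag hgb hcg => ?_⟩
      rw [hrow, hrow a, if_neg hlt.ne, if_pos rfl]
      split_ifs with h1 h2
      · exact hv.le
      · omega
      · exact (hab g hag (by omega) hcg).trans hv.le
  · refine ⟨fun _ _ => rfl, hk, hs, fun g hag hgb hcg => ?_⟩
    rcases Nat.lt_succ_iff_lt_or_eq.1 hgb with h' | rfl
    · exact hab g hag h' hcg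
    · simp only [Test.Holds, Test.holds_eqN, NExp.eval_scalar, NExp.eval_entry, sortKey,
        RExp.eval_get, NExp.eval_get, h12, h13, h14, not_and, not_lt] at h
      exact h hag hcg

theorem wp_sortGoods {N m n : ℕ} {s : Mem} (hm : s.nat 0 0 0 = m) (hn : s.nat 0 1 0 = n)
    (hmN : m ≤ N) (hnN : n ≤ N) :
    sortGoods.wp N (fun s' => ∀ i < n, KeepsCategory m (s.nat 1 · 0) (s'.nat 4 i) ∧
      SortedUpTo m (s.nat 1 · 0) (s.real 0 i) (s'.nat 4 i) m) s := by
  refine wp_forLoop (fun j s' => ∀ i < j, KeepsCategory m (s.nat 1 · 0) (s'.nat 4 i) ∧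
      SortedUpTo m (s.nat 1 · 0) (s.real 0 i) (s'.nat 4 i) m) hnN (by decide) ?_ ?_ ?_ ?_ ?_
  · intro s' hF
    rw [eval_numAgents, hF.nat 0 (by decide), hn]
  · intro j s' i h
    simpa [update_of_ne] using h
  · simp
  · intro i hi s₁ hF₁ h12 hJ₁
    refine wp_forLoop (fun j s' => (∀ i', i' ≠ i → s'.nat 4 i' = s₁.nat 4 i') ∧
      ∀ g < j, s'.nat 4 i g = g) hmN (by decide) ?_ ?_ ?_ ?_ ?_
    · intro s' hF
      rw [eval_numGoods, hF.nat 0 (by decide), hF₁.nat 0 (by decide), hm]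
    · intro j s' i h
      simpa [update_of_ne] using h
    · simp
    · rintro g hg s₂ hF₂ h13 ⟨hrest, hJ₂⟩
      have h12' : s₂.nat 12 0 0 = i := by rw [hF₂.nat 12 (by decide), h12]
      simp only [wp, NExp.eval_scalar, h12', h13]
      refine ⟨fun j hj => ?_, fun x hx => ?_⟩
      · funext x
        simp [hj, hrest j hj]
      · simp only [update_same_array, true_and]
        split_ifs with h
        · exact h.symm
        · exact hJ₂ x (by omega)
    · rintro s₂ hF₂ ⟨hrest₂, hid⟩
      refine wp_forLoop (fun a s' => (∀ i', i' ≠ i → s'.nat 4 i' = s₁.nat 4 i') ∧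
        KeepsCategory m (s.nat 1 · 0) (s'.nat 4 i) ∧
        SortedUpTo m (s.nat 1 · 0) (s.real 0 i) (s'.nat 4 i) a) hmN (by decide) ?_ ?_ ?_ ?_ ?_
      · intro s' hF
        rw [eval_numGoods, hF.nat 0 (by decide), hF₂.nat 0 (by decide), hF₁.nat 0 (by decide), hm]
      · intro j s' i h
        simpa [update_of_ne] using h
      · refine ⟨hrest₂, ⟨fun g hg => by rwa [hid g hg], fun g hg => by rw [hid g hg],
          fun x hx y hy h => ?_⟩, fun g hg => absurd hg (Nat.not_lt_zero g)⟩
        rwa [hid x (by simpa using hx), hid y (by simpa using hy)] at h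
      · rintro a ha s₃ hF₃ h13 ⟨hrest₃, hk₃, hs₃⟩
        refine wp_forLoop (fun b s' => (∀ i', i' ≠ i → s'.nat 4 i' = s₁.nat 4 i') ∧
          KeepsCategory m (s.nat 1 · 0) (s'.nat 4 i) ∧
          SortedUpTo m (s.nat 1 · 0) (s.real 0 i) (s'.nat 4 i) a ∧
          ∀ g, a < g → g < b → s.nat 1 a 0 = s.nat 1 g 0 →
            s.real 0 i (s'.nat 4 i g) ≤ s.real 0 i (s'.nat 4 i a)) hmN (by decide) ?_ ?_ ?_ ?_ ?_
        · intro s' hF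
          rw [eval_numGoods, hF.nat 0 (by decide), hF₃.nat 0 (by decide), hF₂.nat 0 (by decide),
            hF₁.nat 0 (by decide), hm]
        · intro j s' i h
          simpa [update_of_ne] using h
        · exact ⟨hrest₃, hk₃, hs₃, fun g h1 h2 => absurd h2 (Nat.not_lt_zero g)⟩
        · rintro b hb s₄ hF₄ h14 ⟨hrest₄, hk₄, hs₄, hab₄⟩
          have h1 : s₄.nat 1 = s.nat 1 := by
            rw [hF₄.nat 1 (by decide), hF₃.nat 1 (by decide), hF₂.nat 1 (by decide),
              hF₁.nat 1 (by decide)]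
          have h0 : s₄.real 0 = s.real 0 := by
            rw [hF₄.real 0 (by decide), hF₃.real 0 (by decide), hF₂.real 0 (by decide),
              hF₁.real 0 (by decide)]
          have h12' : s₄.nat 12 0 0 = i := by
            rw [hF₄.nat 12 (by decide), hF₃.nat 12 (by decide), hF₂.nat 12 (by decide), h12]
          have h13' : s₄.nat 13 0 0 = a := by rw [hF₄.nat 13 (by decide), h13]
          rw [← h1] at hk₄ hs₄ hab₄ ⊢
          rw [← h0] at hs₄ hab₄ ⊢
          refine wp_mono (wp_exchange h12' h13' h14 ha hb hk₄ hs₄ hab₄) fun s' h' => ?_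
          exact ⟨fun j hj => (h'.1 j hj).trans (hrest₄ j hj), h'.2⟩
        · rintro s₄ hF₄ ⟨hrest₄, hk₄, hs₄, hab₄⟩
          -- After the scan over all `b`, place `a` dominates every later place of its category, so
          -- one more place is sorted.
          refine ⟨hrest₄, hk₄, fun g hg g' hgg' hg' hc => ?_⟩
          rcases Nat.lt_succ_iff_lt_or_eq.1 hg with h | rfl
          · exact hs₄ g h g' hgg' hg' hc
          · exact hab₄ g' hgg' hg' hc
      · rintro s₃ hF₃ ⟨hrest₃, hk₃, hs₃⟩ j hj
        rcases Nat.lt_succ_iff_lt_or_eq.1 hj with h | rfl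
        · rw [hrest₃ j h.ne]
          exact hJ₁ j h
        · exact ⟨hk₃, hs₃⟩
  · exact fun s' _ h => h

/-- The array `5` becomes the array of the offsets of the goods in their categories. -/
def computeOffsets : Prog :=
  forLoop 12 numGoods (forLoop 13 (.scalar 12)
    (cond (.eqN (.entry 1 (.scalar 13)) (.entry 1 (.scalar 12)))
      (setN 5 (.scalar 12) (.const 0) (.add (.entry 5 (.scalar 12)) (.const 1)))))

theorem wp_computeOffsets {N m : ℕ} {s : Mem} (hm : s.nat 0 0 0 = m) (hmN : m ≤ N)
    (h5 : ∀ g, s.nat 5 g 0 = 0) :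
    computeOffsets.wp N (fun s' => ∀ g < m, s'.nat 5 g 0 = offset (s.nat 1 · 0) g) s := by
  refine wp_forLoop (fun j s' => (∀ g < j, s'.nat 5 g 0 = offset (s.nat 1 · 0) g) ∧
    ∀ g, j ≤ g → s'.nat 5 g 0 = 0) hmN (by decide) ?_ ?_ ?_ ?_ ?_
  · intro s' hF
    rw [eval_numGoods, hF.nat 0 (by decide), hm]
  · intro j s' i h
    simpa [update_of_ne] using h
  · simpa using h5
  · rintro g hg s₁ hF₁ h12 ⟨hlt, hge⟩
    refine wp_forLoop (fun b s' => (∀ x, x ≠ g → s'.nat 5 x 0 = s₁.nat 5 x 0) ∧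
      s'.nat 5 g 0 = Nat.count (fun b => s.nat 1 b 0 = s.nat 1 g 0) b) (K := g)
      (by omega) (by decide) ?_ ?_ ?_ ?_ ?_
    · intro s' hF
      rw [NExp.eval_scalar, hF.nat 12 (by decide), h12]
    · intro j s' i h
      simpa [update_of_ne] using h
    · simpa using hge g le_rfl
    · rintro b hb s₂ hF₂ h13 ⟨hrest, hcount⟩
      have h1 : s₂.nat 1 = s.nat 1 := by rw [hF₂.nat 1 (by decide), hF₁.nat 1 (by decide)]
      have h12' : s₂.nat 12 0 0 = g := by rw [hF₂.nat 12 (by decide), h12]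
      refine wp_cond (fun h => ?_) (fun h => ?_)
      · simp only [Test.holds_eqN, NExp.eval_entry, NExp.eval_scalar, h1, h12', h13] at h
        simp only [wp, NExp.eval_scalar, NExp.eval_const, NExp.eval_add, NExp.eval_entry, h12',
          update_same_array]
        refine ⟨fun x hx => by simp [hx, hrest x hx], ?_⟩
        rw [Nat.count_succ, if_pos h, hcount]
        simp
      · simp only [Test.holds_eqN, NExp.eval_entry, NExp.eval_scalar, h1, h12', h13] at h
        refine ⟨hrest, ?_⟩
        rw [Nat.count_succ, if_neg h, hcount, add_zero]
    · rintro s₂ hF₂ ⟨hrest, hcount⟩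
      refine ⟨fun x hx => ?_, fun x hx => ?_⟩
      · rcases Nat.lt_succ_iff_lt_or_eq.1 hx with h | rfl
        · rw [hrest x h.ne, hlt x h]
        · exact hcount
      · rw [hrest x (by omega), hge x (by omega)]
  · exact fun s' _ h => h.1

/-- The array `7` becomes the array of the products of the number of agents and the thresholds. -/
def computeCapacities : Prog :=
  forLoop 12 numCats (forLoop 13 numAgents
    (setN 7 (.scalar 12) (.const 0) (.add (.entry 7 (.scalar 12)) (.entry 2 (.scalar 12)))))

/-- The machine cannot multiply, so the product is formed by `n` additions, starting from cells that
hold `0`. -/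
theorem wp_computeCapacities {N n ℓ : ℕ} {s : Mem} (hn : s.nat 0 1 0 = n) (hℓ : s.nat 0 2 0 = ℓ)
    (hnN : n ≤ N) (hℓN : ℓ ≤ N) (h7 : ∀ h, s.nat 7 h 0 = 0) :
    computeCapacities.wp N (fun s' => ∀ h < ℓ, s'.nat 7 h 0 = n * s.nat 2 h 0) s := by
  refine wp_forLoop (fun j s' => (∀ h < j, s'.nat 7 h 0 = n * s.nat 2 h 0) ∧
    ∀ h, j ≤ h → s'.nat 7 h 0 = 0) hℓN (by decide) ?_ ?_ ?_ ?_ ?_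
  · intro s' hF
    rw [eval_numCats, hF.nat 0 (by decide), hℓ]
  · intro j s' i h
    simpa [update_of_ne] using h
  · simpa using h7
  · rintro g hg s₁ hF₁ h12 ⟨hlt, hge⟩
    refine wp_forLoop (fun b s' => (∀ x, x ≠ g → s'.nat 7 x 0 = s₁.nat 7 x 0) ∧
      s'.nat 7 g 0 = b * s.nat 2 g 0) hnN (by decide) ?_ ?_ ?_ ?_ ?_
    · intro s' hF
      rw [eval_numAgents, hF.nat 0 (by decide), hF₁.nat 0 (by decide), hn]
    · intro j s' i h
      simpa [update_of_ne] using h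
    · simpa using hge g le_rfl
    · rintro b hb s₂ hF₂ h13 ⟨hrest, hprod⟩
      have h2 : s₂.nat 2 = s.nat 2 := by rw [hF₂.nat 2 (by decide), hF₁.nat 2 (by decide)]
      have h12' : s₂.nat 12 0 0 = g := by rw [hF₂.nat 12 (by decide), h12]
      simp only [wp, NExp.eval_scalar, NExp.eval_const, NExp.eval_add, NExp.eval_entry, h12', h2,
        update_same_array]
      refine ⟨fun x hx => by simp [hx, hrest x hx], ?_⟩
      rw [Nat.succ_mul, hprod]
      simp
    · rintro s₂ hF₂ ⟨hrest, hprod⟩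
      refine ⟨fun x hx => ?_, fun x hx => ?_⟩
      · rcases Nat.lt_succ_iff_lt_or_eq.1 hx with h | rfl
        · rw [hrest x h.ne, hlt x h]
        · exact hprod
      · rw [hrest x (by omega), hge x (by omega)]
  · exact fun s' _ h => h.1

end RAM

namespace RAM

open Finset Prog

variable {m n ℓ : ℕ}

/-! ## Allocation of the slots

Natural number arrays: `4` the orders of the agents, `5` the offsets, `6` the first alive offsets of
the categories, `7` the numbers of their remaining slots, `8` the numbers of top slots of the bundle
on offer, `9` the owners of the slots, `10` the flags of the satisfied agents, `11` the flag for a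
bundle given away in the present step, `19` the phase.  Arrays `12` to `18` hold counters and
auxiliary cells. -/

/-- The memory holds the data of the ordered instance. -/
structure Stores (O : OrderedInstance m n ℓ) (s : Mem) : Prop where
  goods : s.nat 0 0 0 = m
  agents : s.nat 0 1 0 = n
  cats : s.nat 0 2 0 = ℓ
  cat : ∀ g, s.nat 1 g 0 = O.c g
  thr : ∀ h, s.nat 2 h 0 = O.k h
  perm : ∀ i g, s.nat 4 i g = O.σ i g
  off : ∀ g < m, s.nat 5 g 0 = offset O.c g
  val : ∀ i g, s.real 0 i g = O.v i g

/-- The program does not overwrite the data of an ordered instance. -/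
def KeepsData (p : Prog) : Prop :=
  (∀ a ∈ [0, 1, 2, 4, 5], a ∉ p.writesN) ∧ 0 ∉ p.writesR

instance (p : Prog) : Decidable (KeepsData p) := inferInstanceAs (Decidable (_ ∧ _))

theorem Stores.of_frame {O : OrderedInstance m n ℓ} {p : Prog} {s s' : Mem} (h : Stores O s)
    (hF : Frame p s s') (hp : KeepsData p) : Stores O s' := by
  have h0 := hF.nat 0 (hp.1 0 (by simp))
  have h1 := hF.nat 1 (hp.1 1 (by simp))
  have h2 := hF.nat 2 (hp.1 2 (by simp))
  have h4 := hF.nat 4 (hp.1 4 (by simp))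
  have h5 := hF.nat 5 (hp.1 5 (by simp))
  have h6 := hF.real 0 hp.2
  obtain ⟨a, b, c, d, e, f, g, i⟩ := h
  constructor <;> simpa only [h0, h1, h2, h4, h5, h6]

/-- Array `7` holds the numbers of slots per category that are left after `r` steps. -/
def Capacities (O : OrderedInstance m n ℓ) (r : ℕ) (s : Mem) : Prop :=
  ∀ h < ℓ, s.nat 7 h 0 = (n - r) * O.k h

/-- Array `8` holds `t`. -/
def Tops (ℓ : ℕ) (t : ℕ → ℕ) (s : Mem) : Prop :=
  ∀ h < ℓ, s.nat 8 h 0 = t h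

/-- The entry of the array `a` for the category of the good in cell `17`. -/
def atCat (a : ℕ) : NExp := .entry a (.entry 1 (.scalar 17))

/-- The good in cell `17` is alive. -/
def liveTest : Test :=
  .and (.not (.ltN (.entry 5 (.scalar 17)) (atCat 6)))
    (.ltN (.entry 5 (.scalar 17)) (.add (atCat 6) (atCat 7)))

/-- The good in cell `17` stays alive if the top slots in array `8` are removed. -/
def nextTest : Test :=
  .and (.not (.ltN (.entry 5 (.scalar 17)) (.add (atCat 6) (atCat 8))))
    (.ltN (.entry 5 (.scalar 17)) (.add (.add (atCat 6) (atCat 8)) (.sub (atCat 7) (atCat 2))))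

theorem holds_liveTest {O : OrderedInstance m n ℓ} {r g : ℕ} {s : Mem} (hs : Stores O s)
    (hc : Capacities O r s) (hg : g < m) (h17 : s.nat 17 0 0 = g) :
    liveTest.Holds s ↔ O.Live (s.nat 6 · 0) (n - r) g := by
  simp only [liveTest, Test.Holds, atCat, NExp.eval_entry, NExp.eval_scalar, NExp.eval_add, h17,
    hs.off g hg, hs.cat, hc _ (O.c_lt g hg), not_lt]
  rfl

theorem holds_nextTest {O : OrderedInstance m n ℓ} {r g : ℕ} {t : ℕ → ℕ} {s : Mem}
    (hs : Stores O s) (hc : Capacities O r s) (ht : Tops ℓ t s) (hg : g < m)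
    (h17 : s.nat 17 0 0 = g) :
    nextTest.Holds s ↔ O.Live (fun h => s.nat 6 h 0 + t h) (n - (r + 1)) g := by
  simp only [nextTest, Test.Holds, atCat, NExp.eval_entry, NExp.eval_scalar, NExp.eval_add,
    NExp.eval_sub, h17, hs.off g hg, hs.cat, hs.thr, hc _ (O.c_lt g hg), ht _ (O.c_lt g hg), not_lt]
  -- Truncated subtraction is compatible with products: `(n - r) * k - k = (n - (r + 1)) * k` holds
  -- without `r < n`.
  rw [← Nat.sub_one_mul, Nat.sub_sub]
  rfl

/-- The value of the slot in cell `17` for the agent in cell `16`. -/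
def slotVal : RExp := .get 0 (.scalar 16) (.get 4 (.scalar 16) (.scalar 17))

/-- Three times the value of the slot. -/
def slotVal₃ : RExp := .add (.add slotVal slotVal) slotVal

/-- The real cell `(0, 0)` of the array `1`. -/
def acc : RExp := .get 1 (.const 0) (.const 0)

/-- Assign a value to `acc`. -/
def setAcc (e : RExp) : Prog := setR 1 (.const 0) (.const 0) e

/-- Compute whether the agent in cell `16` accepts. -/
def evaluate : Prog :=
  seq (setAcc .zero)
    (forLoop 17 numGoods (seq (cond liveTest (setAcc (.sub acc slotVal)))
      (forLoop 18 (.sub numAgents (.scalar 12))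
        (seq (cond liveTest (setAcc (.add acc slotVal₃)))
          (cond nextTest (setAcc (.sub acc slotVal₃)))))))

theorem eval_slotVal {O : OrderedInstance m n ℓ} {i g : ℕ} {s : Mem} (hs : Stores O s)
    (h16 : s.nat 16 0 0 = i) (h17 : s.nat 17 0 0 = g) : slotVal.eval s = O.w i g := by
  simp only [slotVal, RExp.eval_get, NExp.eval_scalar, NExp.eval_get, h16, h17, hs.perm, hs.val]
  rfl

@[simp] theorem eval_acc (s : Mem) : acc.eval s = s.real 1 0 0 := rfl

theorem wp_setAcc {N : ℕ} {e : RExp} {Q : Mem → Prop} {s : Mem} (x : ℝ) (hx : e.eval s = x)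
    (h : ∀ s', s'.real 1 0 0 = x → Q s') : (setAcc e).wp N Q s :=
  h _ (by simp [hx])

/-- Acceptance is the nonnegativity of an expression linear in the values. Its factor `n - r` is
realised by repeating the additions and subtractions for each slot `n - r` times. -/
theorem wp_evaluate {O : OrderedInstance m n ℓ} {N r i : ℕ} {t : ℕ → ℕ} {s : Mem}
    (hmN : m ≤ N) (hnN : n ≤ N) (hs : Stores O s) (hc : Capacities O r s) (ht : Tops ℓ t s)
    (h12 : s.nat 12 0 0 = r) (h16 : s.nat 16 0 0 = i) :
    evaluate.wp N (fun s' => s'.real 1 0 0 = 3 * (n - r : ℕ) * (O.tot i (s.nat 6 · 0) (n - r) -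
      O.tot i (fun h => s.nat 6 h 0 + t h) (n - (r + 1))) - O.tot i (s.nat 6 · 0) (n - r)) s := by
  set A : ℕ → ℝ := fun g => if O.Live (s.nat 6 · 0) (n - r) g then O.w i g else 0 with hA
  set B : ℕ → ℝ := fun g =>
    if O.Live (fun h => s.nat 6 h 0 + t h) (n - (r + 1)) g then O.w i g else 0 with hB
  have key : ∀ s' g, g < m → Stores O s' → (∀ a ∈ [6, 7, 8, 16], s'.nat a = s.nat a) →
      s'.nat 17 0 0 = g → slotVal₃.eval s' = 3 * O.w i g ∧ slotVal.eval s' = O.w i g ∧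
        (liveTest.Holds s' ↔ O.Live (s.nat 6 · 0) (n - r) g) ∧
        (nextTest.Holds s' ↔ O.Live (fun h => s.nat 6 h 0 + t h) (n - (r + 1)) g) := by
    intro s' g hg hs' hF h17
    have hv := eval_slotVal hs' (i := i) (by rw [hF 16 (by simp), h16]) h17
    have hc' : Capacities O r s' := fun h hh => by rw [hF 7 (by simp), hc h hh]
    have ht' : Tops ℓ t s' := fun h hh => by rw [hF 8 (by simp), ht h hh]
    refine ⟨?_, hv, ?_, ?_⟩
    · rw [slotVal₃, RExp.eval_add, RExp.eval_add, hv]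
      ring
    · rw [holds_liveTest hs' hc' hg h17, hF 6 (by simp)]
    · rw [holds_nextTest hs' hc' ht' hg h17, hF 6 (by simp)]
  refine wp_mono (Q := fun s' => s'.real 1 0 0 =
    ∑ g ∈ range m, ((n - r : ℕ) * (3 * A g - 3 * B g) - A g)) ?_ ?_
  · refine wp_seq (wp_setAcc (Q := fun s' => s'.real 1 0 0 = 0) 0 rfl fun _ h => h)
      fun s₀ hF₀ hJ₀ => ?_
    have hs₀ : Stores O s₀ := hs.of_frame hF₀ (by decide)
    refine wp_forLoop (fun j s' => s'.real 1 0 0 =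
      ∑ g ∈ range j, ((n - r : ℕ) * (3 * A g - 3 * B g) - A g)) hmN (by decide) ?_ ?_ ?_ ?_ ?_
    · intro s' hF
      rw [eval_numGoods, hF.nat 0 (by decide), hs₀.goods]
    · exact fun j s' i h => h
    · simpa using hJ₀
    · intro g hg s₁ hF₁ h17 hJ₁
      have hs₁ : Stores O s₁ := hs₀.of_frame hF₁ (by decide)
      have hk₁ : ∀ a ∈ [6, 7, 8, 12, 16], s₁.nat a = s.nat a := fun a ha => by
        rw [hF₁.nat a (by revert a; decide), hF₀.nat a (by revert a; decide)]
      refine wp_seq (P := fun s' => s'.real 1 0 0 =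
        ∑ g ∈ range g, ((n - r : ℕ) * (3 * A g - 3 * B g) - A g) - A g) ?_ fun s₂ hF₂ hJ₂ => ?_
      · obtain ⟨-, hv, hl, -⟩ := key s₁ g hg hs₁ (fun a ha => hk₁ a (by revert a; decide)) h17
        refine wp_cond (fun h => wp_setAcc _ ?_ fun _ h => h) (fun h => ?_)
        · rw [RExp.eval_sub, eval_acc, hJ₁, hv, hA]
          simp only
          rw [if_pos (hl.1 h)]
        · simp only [hJ₁, hA]
          rw [if_neg (fun h' => h (hl.2 h')), sub_zero]
      · have hs₂ : Stores O s₂ := hs₁.of_frame hF₂ (by decide)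
        have hk₂ : ∀ a ∈ [6, 7, 8, 12, 16], s₂.nat a = s.nat a := fun a ha => by
          rw [hF₂.nat a (by revert a; decide), hk₁ a ha]
        have h17₂ : s₂.nat 17 0 0 = g := by rw [hF₂.nat 17 (by decide), h17]
        refine wp_forLoop (fun j s' => s'.real 1 0 0 =
          ∑ g ∈ range g, ((n - r : ℕ) * (3 * A g - 3 * B g) - A g) - A g +
            j * (3 * A g - 3 * B g)) (K := n - r) (by omega) (by decide) ?_ ?_ ?_ ?_ ?_
        · intro s' hF
          rw [NExp.eval_sub, eval_numAgents, NExp.eval_scalar, hF.nat 0 (by decide), hs₂.agents,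
            hF.nat 12 (by decide), hk₂ 12 (by simp), h12]
        · exact fun j s' i h => h
        · simpa using hJ₂
        · intro j hj s₃ hF₃ h18 hJ₃
          have hs₃ : Stores O s₃ := hs₂.of_frame hF₃ (by decide)
          have hk₃ : ∀ a ∈ [6, 7, 8, 16], s₃.nat a = s.nat a := fun a ha => by
            rw [hF₃.nat a (by revert a; decide), hk₂ a (by revert a; decide)]
          have h17₃ : s₃.nat 17 0 0 = g := by rw [hF₃.nat 17 (by decide), h17₂]
          refine wp_seq (P := fun s' => s'.real 1 0 0 = s₃.real 1 0 0 + 3 * A g) ?_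
            fun s₄ hF₄ hJ₄ => ?_
          · obtain ⟨hv, -, hl, -⟩ := key s₃ g hg hs₃ hk₃ h17₃
            refine wp_cond (fun h => wp_setAcc _ ?_ fun _ h => h) (fun h => ?_)
            · rw [RExp.eval_add, eval_acc, hv, hA]
              simp only
              rw [if_pos (hl.1 h)]
            · simp only [hA]
              rw [if_neg (fun h' => h (hl.2 h'))]
              ring
          · have hs₄ : Stores O s₄ := hs₃.of_frame hF₄ (by decide)
            obtain ⟨hv, -, -, hl⟩ := key s₄ g hg hs₄ (fun a ha => by
              rw [hF₄.nat a (by revert a; decide), hk₃ a ha])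
              (by rw [hF₄.nat 17 (by decide), h17₃])
            refine wp_cond (fun h => wp_setAcc _ rfl fun s' h' => ?_) (fun h => ?_)
            · rw [h', RExp.eval_sub, eval_acc, hv, hJ₄, hJ₃]
              push_cast
              simp only [hB]
              rw [if_pos (hl.1 h)]
              ring
            · rw [hJ₄, hJ₃]
              push_cast
              simp only [hB]
              rw [if_neg (fun h' => h (hl.2 h'))]
              ring
        · intro s' _ h
          rw [h, sum_range_succ]
          ring
    · exact fun s' _ h => h
  · intro s' h
    rw [h, sum_sub_distrib, ← mul_sum, sum_sub_distrib, ← mul_sum, ← mul_sum]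
    have h1 : O.tot i (s.nat 6 · 0) (n - r) = ∑ g ∈ range m, A g := by
      unfold OrderedInstance.tot total
      rw [sum_filter]
      rfl
    have h2 : O.tot i (fun h => s.nat 6 h 0 + t h) (n - (r + 1)) = ∑ g ∈ range m, B g := by
      unfold OrderedInstance.tot total
      rw [sum_filter]
      rfl
    rw [h1, h2]
    ring

end RAM

/-! ### Offering bundles and handing them out -/

namespace RAM

open Finset Prog

variable {m n ℓ : ℕ}

/-- Give the bundle to the agent in cell `16`. -/
def give : Prog :=
  seq (setN 11 (.const 0) (.const 0) (.const 1))
    (seq (setN 10 (.scalar 16) (.const 0) (.const 1))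
      (seq (forLoop 17 numGoods (cond (.and liveTest (.not nextTest))
          (setN 9 (.scalar 17) (.const 0) (.scalar 16))))
        (forLoop 17 numCats
          (seq (setN 6 (.scalar 17) (.const 0)
              (.add (.entry 6 (.scalar 17)) (.entry 8 (.scalar 17))))
            (setN 7 (.scalar 17) (.const 0)
              (.sub (.entry 7 (.scalar 17)) (.entry 2 (.scalar 17))))))))

theorem wp_give {O : OrderedInstance m n ℓ} {N r i : ℕ} {t : ℕ → ℕ} {s : Mem}
    (hmN : m ≤ N) (hℓN : ℓ ≤ N) (hs : Stores O s) (hc : Capacities O r s) (ht : Tops ℓ t s)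
    (h16 : s.nat 16 0 0 = i) :
    give.wp N (fun s' => s'.nat 11 0 0 = 1 ∧
      (∀ j, s'.nat 10 j 0 = if j = i then 1 else s.nat 10 j 0) ∧
      (∀ g < m, s'.nat 9 g 0 = if O.Live (s.nat 6 · 0) (n - r) g ∧
        ¬ O.Live (fun h => s.nat 6 h 0 + t h) (n - (r + 1)) g then i else s.nat 9 g 0) ∧
      (∀ h < ℓ, s'.nat 6 h 0 = s.nat 6 h 0 + t h) ∧ Capacities O (r + 1) s') s := by
  refine wp_seq (P := fun s' => s'.nat 11 0 0 = 1) (by simp [wp]) fun s₁ hF₁ h11 => ?_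
  refine wp_seq (P := fun s' => ∀ j, s'.nat 10 j 0 = if j = i then 1 else s.nat 10 j 0) ?_
    fun s₂ hF₂ h10 => ?_
  · intro j
    have := hF₁.nat 16 (by decide)
    have h' := hF₁.nat 10 (by decide)
    simp [this, h16, h']
  have hs₂ : Stores O s₂ := (hs.of_frame hF₁ (by decide)).of_frame hF₂ (by decide)
  have hk₂ : ∀ a ∈ [6, 7, 8, 9, 16], s₂.nat a = s.nat a := fun a ha => by
    rw [hF₂.nat a (by revert a; decide), hF₁.nat a (by revert a; decide)]
  -- The owners are recorded before the windows move, because both tests read the arrays `6` and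
  -- `7`.
  refine wp_seq (P := fun s' => ∀ g < m, s'.nat 9 g 0 = if O.Live (s.nat 6 · 0) (n - r) g ∧
      ¬ O.Live (fun h => s.nat 6 h 0 + t h) (n - (r + 1)) g then i else s.nat 9 g 0) ?_
    fun s₃ hF₃ h9 => ?_
  · refine wp_forLoop (fun j s' => (∀ g < j, s'.nat 9 g 0 =
      if O.Live (s.nat 6 · 0) (n - r) g ∧
        ¬ O.Live (fun h => s.nat 6 h 0 + t h) (n - (r + 1)) g then i else s.nat 9 g 0) ∧
      ∀ g, j ≤ g → s'.nat 9 g 0 = s.nat 9 g 0) hmN (by decide) ?_ ?_ ?_ ?_ ?_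
    · intro s' hF
      rw [eval_numGoods, hF.nat 0 (by decide), hs₂.goods]
    · intro j s' x h
      simpa [update_of_ne] using h
    · exact ⟨fun g hg => absurd hg (Nat.not_lt_zero g), fun g _ => by rw [hk₂ 9 (by simp)]⟩
    · rintro g hg s' hF h17 ⟨hlt, hge⟩
      have hs' : Stores O s' := hs₂.of_frame hF (by decide)
      have hk' : ∀ a ∈ [6, 7, 8, 16], s'.nat a = s.nat a := fun a ha => by
        rw [hF.nat a (by revert a; decide), hk₂ a (by revert a; decide)]
      have hl := holds_liveTest (r := r) hs'
        (fun h hh => by rw [hk' 7 (by simp), hc h hh]) hg h17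
      have hn := holds_nextTest (r := r) (t := t) hs'
        (fun h hh => by rw [hk' 7 (by simp), hc h hh])
        (fun h hh => by rw [hk' 8 (by simp), ht h hh]) hg h17
      rw [hk' 6 (by simp)] at hl hn
      refine wp_cond (fun h => ?_) (fun h => ?_)
      · replace h := And.intro (hl.1 h.1) (fun h' => h.2 (hn.2 h'))
        simp only [wp, NExp.eval_scalar, NExp.eval_const, h17, hk' 16 (by simp), h16,
          update_same_array, and_true]
        refine ⟨fun x hx => ?_, fun x hx => ?_⟩
        · rcases Nat.lt_succ_iff_lt_or_eq.1 hx with h' | rfl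
          · rw [if_neg h'.ne, hlt x h']
          · rw [if_pos rfl, if_pos h]
        · rw [if_neg (by omega), hge x (by omega)]
      · have h' : ¬ (O.Live (s.nat 6 · 0) (n - r) g ∧
            ¬ O.Live (fun h => s.nat 6 h 0 + t h) (n - (r + 1)) g) :=
          fun h' => h ⟨hl.2 h'.1, fun h₂ => h'.2 (hn.1 h₂)⟩
        refine ⟨fun x hx => ?_, fun x hx => hge x (by omega)⟩
        rcases Nat.lt_succ_iff_lt_or_eq.1 hx with hx | rfl
        · exact hlt x hx
        · rw [if_neg h', hge x le_rfl]
    · exact fun s' _ h => fun g hg => h.1 g hg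
  · have hs₃ : Stores O s₃ := hs₂.of_frame hF₃ (by decide)
    have hk₃ : ∀ a ∈ [6, 7, 8], s₃.nat a = s.nat a := fun a ha => by
      rw [hF₃.nat a (by revert a; decide), hk₂ a (by revert a; decide)]
    refine wp_forLoop (fun j s' => (∀ h < j, s'.nat 6 h 0 = s.nat 6 h 0 + t h ∧
        s'.nat 7 h 0 = (n - (r + 1)) * O.k h) ∧
      ∀ h, j ≤ h → s'.nat 6 h 0 = s.nat 6 h 0 ∧ s'.nat 7 h 0 = s.nat 7 h 0)
      hℓN (by decide) ?_ ?_ ?_ ?_ ?_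
    · intro s' hF
      rw [eval_numCats, hF.nat 0 (by decide), hs₃.cats]
    · intro j s' x h
      simpa [update_of_ne] using h
    · exact ⟨fun g hg => absurd hg (Nat.not_lt_zero g), fun g _ => by
        rw [hk₃ 6 (by simp), hk₃ 7 (by simp)]
        exact ⟨rfl, rfl⟩⟩
    · rintro g hg s' hF h17 ⟨hlt, hge⟩
      have hs' : Stores O s' := hs₃.of_frame hF (by decide)
      have h8 : s'.nat 8 g 0 = t g := by
        rw [hF.nat 8 (by decide), hk₃ 8 (by simp), ht g hg]
      simp only [wp, NExp.eval_scalar, NExp.eval_const, NExp.eval_add, NExp.eval_sub,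
        NExp.eval_entry, h17, update_same_array, and_true]
      simp only [update_of_ne _ _ _ _ (show (17 : ℕ) ≠ 6 by decide), h17,
        update_of_ne _ _ _ _ (show (6 : ℕ) ≠ 7 by decide),
        update_of_ne _ _ _ _ (show (7 : ℕ) ≠ 6 by decide),
        update_of_ne _ _ _ _ (show (2 : ℕ) ≠ 6 by decide), update_same_array, and_true]
      refine ⟨fun x hx => ?_, fun x hx => ?_⟩
      · rcases Nat.lt_succ_iff_lt_or_eq.1 hx with h' | rfl
        · rw [if_neg h'.ne, if_neg h'.ne]
          exact hlt x h'
        · rw [if_pos rfl, if_pos rfl, h8, (hge x le_rfl).1, (hge x le_rfl).2, hs'.thr, hc x hg,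
            ← Nat.sub_one_mul, Nat.sub_sub]
          exact ⟨rfl, rfl⟩
      · rw [if_neg (by omega), if_neg (by omega)]
        exact hge x (by omega)
    · rintro s' hF ⟨h, -⟩
      refine ⟨?_, ?_, ?_, fun x hx => (h x hx).1, fun x hx => (h x hx).2⟩
      · rw [hF.nat 11 (by decide), hF₃.nat 11 (by decide), hF₂.nat 11 (by decide), h11]
      · rw [hF.nat 10 (by decide), hF₃.nat 10 (by decide)]
        exact h10
      · rw [hF.nat 9 (by decide)]
        exact h9

/-- Give the bundle to the first agent who accepts it, unless a bundle has been given away. -/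
def offer : Prog :=
  cond (.eqN (.scalar 11) (.const 0)) (forLoop 16 numAgents
    (cond (.and (.eqN (.scalar 11) (.const 0)) (.eqN (.entry 10 (.scalar 16)) (.const 0)))
      (seq evaluate (cond (.not (.ltR acc .zero)) give))))

/-- A bundle has been given away in step `r`, in the phase `q`. -/
structure Given (O : OrderedInstance m n ℓ) (q r : ℕ) (s : Mem) : Prop where
  flag : s.nat 11 0 0 ≠ 0
  progress : O.Progress q (r + 1) (s.nat 6 · 0) (s.nat 9 · 0) (s.nat 10 · 0)
  capacities : Capacities O (r + 1) s

/-- No bundle has been given away yet in step `r`, which started in the memory `s₀`. -/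
def Pending (s₀ s : Mem) : Prop :=
  s.nat 11 0 0 = 0 ∧ ∀ a ∈ [6, 7, 9, 10], s.nat a = s₀.nat a

/-- Loops cannot be left early; instead the flag turns all later offers of the step into no-ops. -/
theorem wp_offer_of_given {N : ℕ} {Q : Mem → Prop} {s : Mem}
    (h : s.nat 11 0 0 ≠ 0) (hQ : Q s) : offer.wp N Q s := by
  refine wp_cond (fun h' => ?_) fun _ => hQ
  simp only [Test.holds_eqN, NExp.eval_scalar, NExp.eval_const] at h'
  exact absurd h' h

/-- Either the first unsatisfied agent who accepts takes the bundle, and `hph` restores the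
invariant, or all of them are known to reject `t`, which is the input for the next offer. Here `s₀`
is the memory at the start of the step, and `q'` and `q` are the phases before and after. -/
theorem wp_offer {O : OrderedInstance m n ℓ} {N q q' r : ℕ} {t : ℕ → ℕ} {s₀ s : Mem}
    (hmN : m ≤ N) (hnN : n ≤ N) (hℓN : ℓ ≤ N) (hs : Stores O s) (hc : Capacities O r s₀)
    (ht : Tops ℓ t s) (h12 : s.nat 12 0 0 = r) (hpend : Pending s₀ s)
    (hprog : O.Progress q' r (s₀.nat 6 · 0) (s₀.nat 9 · 0) (s₀.nat 10 · 0))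
    (htk : ∀ h < ℓ, t h ≤ O.k h)
    (hph : O.Phase q (r + 1) (fun h => s₀.nat 6 h 0 + t h) (s₀.nat 10 · 0)) :
    offer.wp N (fun s' => Given O q r s' ∨ Pending s₀ s' ∧
      ∀ i < n, s₀.nat 10 i 0 = 0 → ¬ O.Accepts r (s₀.nat 6 · 0) t i) s := by
  refine wp_cond (fun _ => ?_) fun h => absurd (by simpa using hpend.1) h
  refine wp_forLoop (fun j s' => Given O q r s' ∨ Pending s₀ s' ∧
    ∀ i < j, s₀.nat 10 i 0 = 0 → ¬ O.Accepts r (s₀.nat 6 · 0) t i) hnN (by decide) ?_ ?_ ?_ ?_ ?_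
  · intro s' hF
    rw [eval_numAgents, hF.nat 0 (by decide), hs.agents]
  · rintro j s' x (⟨h1, h2, h3⟩ | ⟨⟨h1, h2⟩, h3⟩)
    · exact Or.inl ⟨h1, h2, h3⟩
    · exact Or.inr ⟨⟨h1, fun a ha => (update_of_ne _ _ _ _ (by revert a; decide)).trans
        (h2 a ha)⟩, h3⟩
  · exact Or.inr ⟨hpend, fun i hi => absurd hi (Nat.not_lt_zero i)⟩
  · rintro i hi s₁ hF₁ h16 (hJ | ⟨hJ, hrej⟩)
    · refine wp_cond (fun h => ?_) fun _ => Or.inl hJ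
      exact absurd (by simpa using h.1) hJ.flag
    · have hs₁ : Stores O s₁ := hs.of_frame hF₁ (by decide)
      have hc₁ : Capacities O r s₁ := fun h hh => by rw [hJ.2 7 (by simp), hc h hh]
      have ht₁ : Tops ℓ t s₁ := fun h hh => by rw [hF₁.nat 8 (by decide), ht h hh]
      refine wp_cond (fun h => ?_) fun h => Or.inr ⟨hJ, fun j hj hsj => ?_⟩
      · have hsat : s₀.nat 10 i 0 = 0 := by
          have := h.2
          simpa [h16, hJ.2 10 (by simp)] using this
        refine wp_seq (wp_evaluate hmN hnN hs₁ hc₁ ht₁ (by rw [hF₁.nat 12 (by decide), h12]) h16)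
          fun s₂ hF₂ hacc => ?_
        rw [hJ.2 6 (by simp)] at hacc
        have hiff : ¬ (Test.ltR acc .zero).Holds s₂ ↔ O.Accepts r (s₀.nat 6 · 0) t i := by
          simp only [Test.Holds, eval_acc, RExp.eval_zero, hacc, OrderedInstance.Accepts, not_lt,
            sub_nonneg]
        have hs₂ : Stores O s₂ := hs₁.of_frame hF₂ (by decide)
        have hk₂ : ∀ a ∈ [6, 7, 9, 10], s₂.nat a = s₀.nat a := fun a ha => by
          rw [hF₂.nat a (by revert a; decide), hJ.2 a ha]
        refine wp_cond (fun h' => ?_) fun h' => Or.inr ⟨⟨?_, hk₂⟩, fun j hj hsj => ?_⟩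
        · refine wp_mono (wp_give hmN hℓN hs₂ (r := r)
            (fun h hh => by rw [hk₂ 7 (by simp), hc h hh])
            (fun h hh => by rw [hF₂.nat 8 (by decide), ht₁ h hh])
            (by rw [hF₂.nat 16 (by decide), h16])) fun s' h'' => ?_
          obtain ⟨h11, h10, h9, h6, h7⟩ := h''
          rw [hk₂ 6 (by simp)] at h9 h6
          rw [hk₂ 9 (by simp)] at h9
          rw [hk₂ 10 (by simp)] at h10
          exact Or.inl ⟨by rw [h11]; exact one_ne_zero,
            hprog.succ hi hsat htk (hiff.1 h') h6 h9 h10 hph, h7⟩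
        · rw [hF₂.nat 11 (by decide), hJ.1]
        · rcases Nat.lt_succ_iff_lt_or_eq.1 hj with hj | rfl
          · exact hrej j hj hsj
          · exact fun hA => h' (hiff.2 hA)
      · rcases Nat.lt_succ_iff_lt_or_eq.1 hj with hj | rfl
        · exact hrej j hj hsj
        · refine absurd ⟨?_, ?_⟩ h
          · simpa using hJ.1
          · simpa [h16, hJ.2 10 (by simp)] using hsj
  · exact fun s' _ h => h

/-- Top slots are only tried for the good in cell `13`: the entry of the array `a` for its
category. -/
def atCat₁₃ (a : ℕ) : NExp := .entry a (.entry 1 (.scalar 13))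

/-- Offer the bundles with a single top slot. -/
def offerSingles : Prog :=
  forLoop 13 numGoods (cond (.and (.eqN (.entry 5 (.scalar 13)) (atCat₁₃ 6))
      (.ltN (.const 0) (atCat₁₃ 2)))
    (seq (setN 8 (.entry 1 (.scalar 13)) (.const 0) (.const 1))
      (seq offer (setN 8 (.entry 1 (.scalar 13)) (.const 0) (.const 0)))))

/-- Offer the bundles that arise by adding top slots one by one. -/
def offerGrowing : Prog :=
  forLoop 13 numGoods (cond (.and (.eqN (.entry 5 (.scalar 13)) (.add (atCat₁₃ 6) (atCat₁₃ 8)))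
      (.ltN (atCat₁₃ 8) (atCat₁₃ 2)))
    (seq (setN 8 (.entry 1 (.scalar 13)) (.const 0) (.add (atCat₁₃ 8) (.const 1))) offer))

/-- Give away one bundle. The phase is in cell `19`. -/
def allocateBundle : Prog :=
  seq (setN 11 (.const 0) (.const 0) (.const 0))
    (seq (forLoop 13 numCats (setN 8 (.scalar 13) (.const 0) (.const 0)))
      (seq (cond (.eqN (.scalar 19) (.const 0)) offerSingles)
        (seq (cond (.eqN (.scalar 11) (.const 0)) (setN 19 (.const 0) (.const 0) (.const 1)))
          (seq offer offerGrowing))))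

section Step

variable {O : OrderedInstance m n ℓ} {N q r : ℕ} {s₀ s : Mem}

theorem Given.congr {s' : Mem} (h : Given O q r s)
    (hs : ∀ a ∈ [6, 7, 9, 10, 11], s'.nat a = s.nat a) : Given O q r s' := by
  obtain ⟨h1, h2, h3⟩ := h
  refine ⟨by rwa [hs 11 (by simp)], by rwa [hs 6 (by simp), hs 9 (by simp), hs 10 (by simp)], ?_⟩
  intro x hx
  rw [hs 7 (by simp), h3 x hx]

theorem Pending.congr {s' : Mem} (h : Pending s₀ s)
    (hs : ∀ a ∈ [6, 7, 9, 10, 11], s'.nat a = s.nat a) : Pending s₀ s' :=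
  ⟨by rw [hs 11 (by simp), h.1], fun a ha => by rw [hs a (by revert a; decide), h.2 a ha]⟩

/-- The second outcome is the hypothesis of `Phase.normal`. Array `8` is reset after every offer, so
each bundle has a single top slot. -/
theorem wp_offerSingles (hmN : m ≤ N) (hnN : n ≤ N) (hℓN : ℓ ≤ N) (hs : Stores O s)
    (hc : Capacities O r s₀) (ht : Tops ℓ (fun _ => 0) s) (h12 : s.nat 12 0 0 = r)
    (hpend : Pending s₀ s)
    (hprog : O.Progress 0 r (s₀.nat 6 · 0) (s₀.nat 9 · 0) (s₀.nat 10 · 0)) :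
    offerSingles.wp N (fun s' => Given O 0 r s' ∨ Pending s₀ s' ∧ Tops ℓ (fun _ => 0) s' ∧
      ∀ g < m, offset O.c g = s₀.nat 6 (O.c g) 0 → 0 < O.k (O.c g) → ∀ i < n,
        s₀.nat 10 i 0 = 0 →
        ¬ O.Accepts r (s₀.nat 6 · 0) (fun h => if h = O.c g then 1 else 0) i) s := by
  have hsum : ∑ h ∈ range ℓ, s₀.nat 6 h 0 = r := by
    rcases hprog.phase with ⟨-, h⟩ | ⟨h, -⟩
    · exact h
    · exact absurd rfl h
  refine wp_forLoop (fun j s' => Given O 0 r s' ∨ Pending s₀ s' ∧ Tops ℓ (fun _ => 0) s' ∧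
    ∀ g < j, offset O.c g = s₀.nat 6 (O.c g) 0 → 0 < O.k (O.c g) → ∀ i < n,
      s₀.nat 10 i 0 = 0 →
      ¬ O.Accepts r (s₀.nat 6 · 0) (fun h => if h = O.c g then 1 else 0) i)
    hmN (by decide) ?_ ?_ ?_ ?_ ?_
  · intro s' hF
    rw [eval_numGoods, hF.nat 0 (by decide), hs.goods]
  · intro j s' x h
    have hk : ∀ a ∈ [6, 7, 9, 10, 11], update s'.nat 13 0 0 x a = s'.nat a := fun a ha =>
      update_of_ne _ _ _ _ (by revert a; decide)
    rcases h with h | ⟨h1, h2, h3⟩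
    · exact Or.inl (h.congr hk)
    · refine Or.inr ⟨h1.congr hk, fun y hy => ?_, h3⟩
      rw [← h2 y hy]
      simp [update_of_ne]
  · exact Or.inr ⟨hpend, ht, fun g hg => absurd hg (Nat.not_lt_zero g)⟩
  · rintro g hg s₁ hF₁ h13 hJ
    have hs₁ : Stores O s₁ := hs.of_frame hF₁ (by decide)
    have hcat : (NExp.entry 1 (.scalar 13)).eval s₁ = O.c g := by
      rw [NExp.eval_entry, NExp.eval_scalar, h13, hs₁.cat]
    refine wp_cond (fun h => ?_) (fun h => ?_)
    · refine wp_seq (P := fun s' => s'.nat 8 = fun x y => if x = O.c g ∧ y = 0 then 1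
          else s₁.nat 8 x y) ?_ fun s₂ hF₂ h8 => ?_
      · simp only [wp, hcat]
        funext x y
        simp
      have hk₂ : ∀ a ∈ [6, 7, 9, 10, 11], s₂.nat a = s₁.nat a := fun a ha =>
        hF₂.nat a (by revert a; decide)
      have hs₂ : Stores O s₂ := hs₁.of_frame hF₂ (by decide)
      have hcat₂ : (NExp.entry 1 (.scalar 13)).eval s₂ = O.c g := by
        rw [NExp.eval_entry, NExp.eval_scalar, hF₂.nat 13 (by decide), h13, hs₂.cat]
      rcases hJ with hJ | ⟨hp, ht₁, hrej⟩
      · have hJ₂ := hJ.congr hk₂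
        refine wp_seq (wp_offer_of_given (Q := Given O 0 r) hJ₂.flag hJ₂) fun s₃ hF₃ h₃ => ?_
        exact Or.inl (h₃.congr fun a ha => update_of_ne _ _ _ _ (by revert a; decide))
      · have hg6 : offset O.c g = s₀.nat 6 (O.c g) 0 ∧ 0 < O.k (O.c g) := by
          have h1 := h.1
          have h2 := h.2
          simp only [Test.holds_eqN, Test.Holds, atCat₁₃, NExp.eval_entry, NExp.eval_scalar, h13,
            hs₁.off g hg, hs₁.cat, hs₁.thr, hp.2 6 (by simp), NExp.eval_const] at h1 h2
          exact ⟨h1, h2⟩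
        refine wp_seq (wp_offer (q := 0) hmN hnN hℓN hs₂ hc (t := fun h => if h = O.c g then 1 else 0)
          (fun x hx => ?_) (by rw [hF₂.nat 12 (by decide), hF₁.nat 12 (by decide), h12])
          (hp.congr hk₂) hprog (fun x hx => ?_) (Or.inl ⟨rfl, ?_⟩)) fun s₃ hF₃ h₃ => ?_
        · rw [h8]
          simp only [and_true]
          split_ifs
          · rfl
          · exact ht₁ x hx
        · split_ifs with hx'
          · rw [hx']
            exact hg6.2
          · exact Nat.zero_le _
        -- One bundle uses up exactly one top slot, which keeps the count of phase `0`.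
        · rw [sum_add_distrib, hsum, sum_ite_eq', if_pos (mem_range.2 (O.c_lt g hg))]
        · have hcat₃ : (NExp.entry 1 (.scalar 13)).eval s₃ = O.c g := by
            rw [NExp.eval_entry, NExp.eval_scalar, hF₃.nat 13 (by decide), hF₃.nat 1 (by decide)]
            exact hcat₂
          have hk : ∀ a ∈ [6, 7, 9, 10, 11], update s₃.nat 8
              ((NExp.entry 1 (.scalar 13)).eval s₃) ((NExp.const 0).eval s₃)
              ((NExp.const 0).eval s₃) a = s₃.nat a := fun a ha =>
            update_of_ne _ _ _ _ (by revert a; decide)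
          rcases h₃ with h₃ | ⟨hp₃, hrej₃⟩
          · exact Or.inl (h₃.congr hk)
          · refine Or.inr ⟨hp₃.congr hk, fun x hx => ?_, fun b hb => ?_⟩
            · simp only [hcat₃, update_same_array, NExp.eval_const, and_true]
              split_ifs with hx'
              · rfl
              · rw [hF₃.nat 8 (by decide), h8]
                simp only [hx', false_and, if_false]
                exact ht₁ x hx
            · rcases Nat.lt_succ_iff_lt_or_eq.1 hb with hb | rfl
              · exact hrej b hb
              · exact fun _ _ => hrej₃
    · rcases hJ with hJ | ⟨hp, ht₁, hrej⟩
      · exact Or.inl hJ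
      · refine Or.inr ⟨hp, ht₁, fun b hb => ?_⟩
        rcases Nat.lt_succ_iff_lt_or_eq.1 hb with hb | rfl
        · exact hrej b hb
        · intro h1 h2
          refine absurd ⟨?_, ?_⟩ h
          · simp only [Test.holds_eqN, atCat₁₃, NExp.eval_entry, NExp.eval_scalar, h13,
              hs₁.off b hg, hs₁.cat, hp.2 6 (by simp), h1]
          · simpa only [Test.Holds, atCat₁₃, NExp.eval_entry, NExp.eval_scalar, h13,
              hs₁.cat, hs₁.thr, NExp.eval_const] using h2
  · exact fun s' _ h => h

/-- A single pass suffices because the goods of a category are met in the order of their offsets: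
each scanned good lies above the end of the top slots collected so far or below the top layer. If
nobody accepted during the pass, the top layer would have been rejected. -/
theorem wp_offerGrowing {q' : ℕ} (hmN : m ≤ N) (hnN : n ≤ N) (hℓN : ℓ ≤ N) (hs : Stores O s)
    (hc : Capacities O r s₀) (h12 : s.nat 12 0 0 = r) (hrn : r < n)
    (hprog : O.Progress q r (s₀.nat 6 · 0) (s₀.nat 9 · 0) (s₀.nat 10 · 0))
    (h : Given O q' r s ∨ (q' ≠ 0 ∧ O.Normal r (s₀.nat 6 · 0) (s₀.nat 10 · 0)) ∧ Pending s₀ s ∧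
      Tops ℓ (fun _ => 0) s ∧
      ∀ i < n, s₀.nat 10 i 0 = 0 → ¬ O.Accepts r (s₀.nat 6 · 0) (fun _ => 0) i) :
    offerGrowing.wp N (Given O q' r) s := by
  obtain ⟨M, hM⟩ : ∃ M, n - r = M + 1 := ⟨n - r - 1, by omega⟩
  refine wp_forLoop (fun j s' => Given O q' r s' ∨
    (q' ≠ 0 ∧ O.Normal r (s₀.nat 6 · 0) (s₀.nat 10 · 0)) ∧ Pending s₀ s' ∧ ∃ t, Tops ℓ t s' ∧
    (∀ h < ℓ, t h ≤ O.k h) ∧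
    (∀ g < m, g < j → offset O.c g < s₀.nat 6 (O.c g) 0 + t (O.c g) ∨
      s₀.nat 6 (O.c g) 0 + O.k (O.c g) ≤ offset O.c g) ∧
    ∀ i < n, s₀.nat 10 i 0 = 0 → ¬ O.Accepts r (s₀.nat 6 · 0) t i)
    hmN (by decide) ?_ ?_ ?_ ?_ ?_
  · intro s' hF
    rw [eval_numGoods, hF.nat 0 (by decide), hs.goods]
  · intro j s' x h
    have hk : ∀ a ∈ [6, 7, 9, 10, 11], update s'.nat 13 0 0 x a = s'.nat a := fun a ha =>
      update_of_ne _ _ _ _ (by revert a; decide)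
    rcases h with h | ⟨hq, h1, t, h2, h3⟩
    · exact Or.inl (h.congr hk)
    · refine Or.inr ⟨hq, h1.congr hk, t, fun y hy => ?_, h3⟩
      rw [← h2 y hy]
      simp [update_of_ne]
  · exact h.imp_right fun ⟨hq, hpend, ht, hrej⟩ => ⟨hq, hpend, _, ht, fun _ _ => Nat.zero_le _,
      fun g _ hg => absurd hg (Nat.not_lt_zero g), hrej⟩
  · rintro g hg s₁ hF₁ h13 hJ
    have hs₁ : Stores O s₁ := hs.of_frame hF₁ (by decide)
    refine wp_cond (fun h => ?_) (fun h => ?_)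
    · refine wp_seq (P := fun s' => ∀ x, s'.nat 8 x 0 = if x = O.c g then s₁.nat 8 x 0 + 1
          else s₁.nat 8 x 0) ?_ fun s₂ hF₂ h8 => ?_
      · intro x
        simp only [atCat₁₃, NExp.eval_entry, NExp.eval_scalar, NExp.eval_const, NExp.eval_add, h13,
          hs₁.cat, update_same_array, and_true]
        split_ifs with hx
        · rw [hx]
        · rfl
      have hk₂ : ∀ a ∈ [6, 7, 9, 10, 11], s₂.nat a = s₁.nat a := fun a ha =>
        hF₂.nat a (by revert a; decide)
      have hs₂ : Stores O s₂ := hs₁.of_frame hF₂ (by decide)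
      rcases hJ with hJ | ⟨hq, hp, t, ht₁, htk, hpre, hrej₁⟩
      · have hJ₂ := hJ.congr hk₂
        exact wp_offer_of_given hJ₂.flag (Or.inl hJ₂)
      · have hcl := O.c_lt g hg
        obtain ⟨hgo, hgk⟩ : offset O.c g = s₀.nat 6 (O.c g) 0 + t (O.c g) ∧
            t (O.c g) < O.k (O.c g) := by
          have h1 := h.1
          have h2 := h.2
          simp only [Test.holds_eqN, Test.Holds, atCat₁₃, NExp.eval_entry, NExp.eval_scalar, h13,
            hs₁.off g hg, hs₁.cat, hs₁.thr, hp.2 6 (by simp), NExp.eval_add, ht₁ _ hcl] at h1 h2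
          exact ⟨h1, h2⟩
        set t' : ℕ → ℕ := fun x => if x = O.c g then t x + 1 else t x with ht'
        have htk' : ∀ x < ℓ, t' x ≤ O.k x := fun x hx => by
          simp only [ht']
          split_ifs with hx'
          · rw [hx']
            exact hgk
          · exact htk x hx
        have ht₂ : Tops ℓ t' s₂ := fun x hx => by rw [h8, ht₁ x hx]
        refine wp_conseq (wp_offer (q := q') hmN hnN hℓN hs₂ hc ht₂
          (by rw [hF₂.nat 12 (by decide), hF₁.nat 12 (by decide), h12]) (hp.congr hk₂) hprog htk'
          (Or.inr ⟨hq.1,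
            hq.2.succ hM hg htk hgo hgk (fun _ => rfl) hrej₁⟩)) fun s' hF' h' => ?_
        refine h'.imp id fun h' => ⟨hq, h'.1, t', fun x hx => ?_, htk', fun b hb hbg => ?_, h'.2⟩
        · rw [hF'.nat 8 (by decide), ht₂ x hx]
        · rcases Nat.lt_succ_iff_lt_or_eq.1 hbg with hbg | rfl
          · refine (hpre b hb hbg).imp_left fun h' => ?_
            simp only [ht']
            split_ifs <;> omega
          · left
            simp only [ht', if_true]
            omega
    · refine hJ.imp id fun ⟨hq, hp, t, ht₁, htk, hpre, hrej₁⟩ =>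
        ⟨hq, hp, t, ht₁, htk, fun b hb hbg => ?_, hrej₁⟩
      rcases Nat.lt_succ_iff_lt_or_eq.1 hbg with hbg | rfl
      · exact hpre b hb hbg
      by_contra hcon
      push Not at hcon
      rcases hcon.1.eq_or_lt with ho | ho
      · refine h ⟨?_, ?_⟩
        · simp only [Test.holds_eqN, atCat₁₃, NExp.eval_entry, NExp.eval_scalar, NExp.eval_add, h13,
            hs₁.off b hb, hs₁.cat, hp.2 6 (by simp), ht₁ _ (O.c_lt b hb), ho]
        · simp only [Test.Holds, atCat₁₃, NExp.eval_entry, NExp.eval_scalar, h13, hs₁.cat, hs₁.thr,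
            ht₁ _ (O.c_lt b hb)]
          omega
      -- The good that is next in line for the bundle would precede `b`, and the scan has already
      -- dealt with it.
      · obtain ⟨x, hx, hxc, hxo⟩ := exists_offset_eq_of_lt ho
        have := hpre x (hx.trans hb) hx
        rw [hxc, hxo] at this
        omega
  · rintro s' hF (h | ⟨-, hp, t, -, htk, hpre, hrej'⟩)
    · exact h
    -- Since `r < n`, some agent is unsatisfied, and she would accept the top layer.
    · obtain ⟨i, hi⟩ : {i ∈ range n | s₀.nat 10 i 0 = 0}.Nonempty := by
        rw [← card_pos]
        have := hprog.card
        omega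
      simp only [mem_filter, mem_range] at hi
      exact absurd (OrderedInstance.accepts_of_forall hM hi.1 htk fun g hg => hpre g hg hg)
        (hrej' i hi.1 hi.2)

/-- In phase `0` the step either ends with a single-slot bundle or establishes normality and sets
the phase to `1`; in a normal state the bottom layer and then the growing bundles are offered, one
of which is accepted. -/
theorem wp_allocateBundle (hmN : m ≤ N) (hnN : n ≤ N) (hℓN : ℓ ≤ N) (hs : Stores O s)
    (hc : Capacities O r s) (h12 : s.nat 12 0 0 = r) (hrn : r < n)
    (hprog : O.Progress (s.nat 19 0 0) r (s.nat 6 · 0) (s.nat 9 · 0) (s.nat 10 · 0)) :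
    allocateBundle.wp N (fun s' => Given O (s'.nat 19 0 0) r s') s := by
  obtain ⟨M, hM⟩ : ∃ M, n - r = M + 1 := ⟨n - r - 1, by omega⟩
  refine wp_seq (P := fun s' => s'.nat 11 0 0 = 0) (by simp [wp]) fun s₁ hF₁ h11 => ?_
  have hs₁ : Stores O s₁ := hs.of_frame hF₁ (by decide)
  refine wp_seq (P := Tops ℓ fun _ => 0) ?_ fun s₂ hF₂ ht₂ => ?_
  · refine wp_forLoop (fun j s' => ∀ h < j, s'.nat 8 h 0 = 0) hℓN (by decide) ?_ ?_ ?_ ?_ ?_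
    · intro s' hF
      rw [eval_numCats, hF.nat 0 (by decide), hs₁.cats]
    · intro j s' x h
      simpa [update_of_ne] using h
    · simp
    · intro x hx s' hF h13 hJ y hy
      simp only [NExp.eval_scalar, NExp.eval_const, h13, update_same_array, and_true]
      split_ifs with h
      · rfl
      · exact hJ y (by omega)
    · exact fun s' _ h => h
  have hs₂ : Stores O s₂ := hs₁.of_frame hF₂ (by decide)
  have hk₂ : ∀ a ∈ [6, 7, 9, 10, 12, 19], s₂.nat a = s.nat a := fun a ha => by
    rw [hF₂.nat a (by revert a; decide), hF₁.nat a (by revert a; decide)]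
  have hp₂ : Pending s s₂ :=
    ⟨by rw [hF₂.nat 11 (by decide), h11], fun a ha => hk₂ a (by revert a; decide)⟩
  have h12₂ : s₂.nat 12 0 0 = r := by rw [hk₂ 12 (by simp), h12]
  refine wp_seq (P := fun s' => Given O (s'.nat 19 0 0) r s' ∨ Pending s s' ∧
    Tops ℓ (fun _ => 0) s' ∧ O.Normal r (s.nat 6 · 0) (s.nat 10 · 0)) ?_ fun s₃ hF₃ hJ₃ => ?_
  · refine wp_cond (fun h => ?_) fun h => Or.inr ⟨hp₂, ht₂, ?_⟩
    · have h19 : s.nat 19 0 0 = 0 := by simpa [hk₂ 19 (by simp)] using h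
      rw [h19] at hprog
      refine wp_conseq (wp_offerSingles hmN hnN hℓN hs₂ hc ht₂ h12₂ hp₂ hprog) fun s' hF h' => ?_
      have h19' : s'.nat 19 0 0 = 0 := by rw [hF.nat 19 (by decide), hk₂ 19 (by simp), h19]
      rw [h19']
      exact h'.imp id fun h' => ⟨h'.1, h'.2.1, hprog.phase.normal hM h'.2.2⟩
    · rcases hprog.phase with ⟨h', -⟩ | ⟨-, h'⟩
      · exact absurd (by simpa [hk₂ 19 (by simp)] using h') h
      · exact h'
  have hs₃ : Stores O s₃ := hs₂.of_frame hF₃ (by decide)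
  refine wp_seq (P := fun s' => Given O (s'.nat 19 0 0) r s' ∨ s'.nat 19 0 0 = 1 ∧ Pending s s' ∧
    Tops ℓ (fun _ => 0) s' ∧ O.Normal r (s.nat 6 · 0) (s.nat 10 · 0)) ?_ fun s₄ hF₄ hJ₄ => ?_
  · refine wp_cond (fun h => ?_) fun h => ?_
    · have hk : ∀ a ∈ [6, 7, 8, 9, 10, 11], update s₃.nat 19 0 0 1 a = s₃.nat a := fun a ha =>
        update_of_ne _ _ _ _ (by revert a; decide)
      rcases hJ₃ with hJ₃ | ⟨hp₃, ht₃, hn⟩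
      · exact absurd (by simpa using h) hJ₃.flag
      · refine Or.inr ⟨by simp, hp₃.congr fun a ha => hk a (by revert a; decide), fun x hx => ?_, hn⟩
        rw [← ht₃ x hx]
        exact congrFun (congrFun (hk 8 (by simp)) x) 0
    · refine hJ₃.imp id fun h' => absurd ?_ h
      simpa using h'.1.1
  have hs₄ : Stores O s₄ := hs₃.of_frame hF₄ (by decide)
  have h12₄ : s₄.nat 12 0 0 = r := by
    rw [hF₄.nat 12 (by decide), hF₃.nat 12 (by decide), h12₂]
  refine wp_conseq (Q := Given O (s₄.nat 19 0 0) r) ?_ fun s' hF h => ?_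
  · refine wp_seq (P := fun s' => Given O (s₄.nat 19 0 0) r s' ∨
      (s₄.nat 19 0 0 ≠ 0 ∧ O.Normal r (s.nat 6 · 0) (s.nat 10 · 0)) ∧ Pending s s' ∧
      Tops ℓ (fun _ => 0) s' ∧
      ∀ i < n, s.nat 10 i 0 = 0 → ¬ O.Accepts r (s.nat 6 · 0) (fun _ => 0) i) ?_
      fun s₅ hF₅ hJ₅ => wp_offerGrowing hmN hnN hℓN (hs₄.of_frame hF₅ (by decide)) hc
        (by rw [hF₅.nat 12 (by decide), h12₄]) hrn hprog hJ₅
    rcases hJ₄ with hJ₄ | ⟨h19, hp₄, ht₄, hn⟩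
    · exact wp_offer_of_given hJ₄.flag (Or.inl hJ₄)
    · have hq : s₄.nat 19 0 0 ≠ 0 := by omega
      refine wp_conseq (wp_offer hmN hnN hℓN hs₄ hc ht₄ h12₄ hp₄ hprog (fun _ _ => Nat.zero_le _)
        (Or.inr ⟨hq, hn.zero hM⟩)) fun s' hF h => h.imp_right fun h => ⟨⟨hq, hn⟩, h.1, ?_, h.2⟩
      intro x hx
      rw [hF.nat 8 (by decide), ht₄ x hx]
  · rwa [hF.nat 19 (by decide)]

/-- Give away all bundles. -/
def allocateSlots : Prog := forLoop 12 numAgents allocateBundle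

theorem wp_allocateSlots (hmN : m ≤ N) (hnN : n ≤ N) (hℓN : ℓ ≤ N) (hs : Stores O s)
    (hc : Capacities O 0 s)
    (hprog : O.Progress (s.nat 19 0 0) 0 (s.nat 6 · 0) (s.nat 9 · 0) (s.nat 10 · 0)) :
    allocateSlots.wp N (fun s' =>
      O.Progress (s'.nat 19 0 0) n (s'.nat 6 · 0) (s'.nat 9 · 0) (s'.nat 10 · 0)) s := by
  refine wp_forLoop (fun r s' => Capacities O r s' ∧
    O.Progress (s'.nat 19 0 0) r (s'.nat 6 · 0) (s'.nat 9 · 0) (s'.nat 10 · 0))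
    hnN (by decide) ?_ ?_ ⟨hc, hprog⟩ ?_ fun s' _ h => h.2
  · intro s' hF
    rw [eval_numAgents, hF.nat 0 (by decide), hs.agents]
  · rintro r s' x ⟨h1, h2⟩
    refine ⟨fun y hy => ?_, ?_⟩
    · rw [← h1 y hy]
      simp [update_of_ne]
    · simpa [update_of_ne] using h2
  · rintro r hr s' hF h12 ⟨h1, h2⟩
    exact wp_mono (wp_allocateBundle hmN hnN hℓN (hs.of_frame hF (by decide)) h1 h12 hr h2)
      fun s'' h => ⟨h.capacities, h.progress⟩

end Step

end RAM

/-! ### Exchanging slots for goods -/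

open Finset in
/-- The injection `π` assigns to each of the first `j` slots a good of the same category that is at
least as valuable for the owner of the slot as the slot. -/
structure OrderedInstance.Picked {m n ℓ : ℕ} (O : OrderedInstance m n ℓ) (own : ℕ → ℕ) (j : ℕ)
    (π out flag : ℕ → ℕ) : Prop where
  lt : ∀ g < j, π g < m
  cat : ∀ g < j, O.c (π g) = O.c g
  out_eq : ∀ g < j, out (π g) = own g
  le : ∀ g < j, O.w (own g) g ≤ O.v (own g) (π g)
  inj : Set.InjOn π (range j)
  flag_iff : ∀ x, flag x ≠ 0 ↔ ∃ g < j, π g = x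

namespace OrderedInstance

open Finset

variable {m n ℓ : ℕ} {O : OrderedInstance m n ℓ} {own π out flag : ℕ → ℕ} {j : ℕ}

/-- Pigeonhole: the category of `j` has one more place among `0, …, j` than slots before `j`, and
only those slots have picked goods of this category. -/
theorem Picked.exists_flag_eq_zero (h : O.Picked own j π out flag) (hj : j < m)
    (hown : own j < n) : ∃ b ≤ j, O.c b = O.c j ∧ flag (O.σ (own j) b) = 0 := by
  by_contra! hcon
  have h1 : #{b ∈ range (j + 1) | O.c b = O.c j} ≤ #({g ∈ range j | O.c g = O.c j}.image π) := by
    refine card_le_card_of_injOn (O.σ (own j)) (fun b hb => ?_) fun x hx y hy hxy => ?_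
    · simp only [coe_filter, mem_range, Set.mem_ofPred_eq] at hb
      obtain ⟨g, hg, hgb⟩ := (h.flag_iff _).1 (hcon b (by omega) hb.2)
      simp only [coe_image, Set.mem_image, coe_filter, mem_range, Set.mem_ofPred_eq]
      refine ⟨g, ⟨hg, ?_⟩, hgb⟩
      rw [← h.cat g hg, hgb, O.c_σ _ hown b (by omega), hb.2]
    · simp only [coe_filter, mem_range, Set.mem_ofPred_eq] at hx hy
      exact O.σ_inj _ hown (by simp; omega) (by simp; omega) hxy
  have h2 : #{b ∈ range (j + 1) | O.c b = O.c j} = #{g ∈ range j | O.c g = O.c j} + 1 := by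
    rw [range_add_one, filter_insert, if_pos rfl, card_insert_of_notMem (by simp)]
  have h3 := card_image_le (s := {g ∈ range j | O.c g = O.c j}) (f := π)
  omega

theorem Picked.succ {out' flag' : ℕ → ℕ} {x : ℕ} (h : O.Picked own j π out flag) (hx : x < m)
    (hc : O.c x = O.c j) (hle : O.w (own j) j ≤ O.v (own j) x) (hflag : flag x = 0)
    (hout : ∀ y, out' y = if y = x then own j else out y)
    (hflag' : ∀ y, flag' y = if y = x then 1 else flag y) :
    O.Picked own (j + 1) (Function.update π j x) out' flag' := by
  have hne : ∀ g < j, Function.update π j x g = π g := fun g hg =>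
    Function.update_of_ne hg.ne _ _
  have hfresh : ∀ g < j, π g ≠ x := fun g hg hgx => (h.flag_iff x).2 ⟨g, hg, hgx⟩ hflag
  have hall : ∀ {P : ℕ → Prop}, (∀ g < j, P g) → P j → ∀ g < j + 1, P g := by
    intro P h1 h2 g hg
    rcases Nat.lt_succ_iff_lt_or_eq.1 hg with hg | rfl
    exacts [h1 g hg, h2]
  refine ⟨hall (fun g hg => hne g hg ▸ h.lt g hg) (by simpa),
    hall (fun g hg => hne g hg ▸ h.cat g hg) (by simpa),
    hall (fun g hg => ?_) (by simp [hout]),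
    hall (fun g hg => hne g hg ▸ h.le g hg) (by simpa), ?_, fun y => ?_⟩
  · rw [hne g hg, hout, if_neg (hfresh g hg), h.out_eq g hg]
  · intro a ha b hb hab
    simp only [coe_range, Set.mem_Iio] at ha hb
    rcases Nat.lt_succ_iff_lt_or_eq.1 ha with ha | rfl <;>
      rcases Nat.lt_succ_iff_lt_or_eq.1 hb with hb | rfl
    · rw [hne a ha, hne b hb] at hab
      exact h.inj (by simpa) (by simpa) hab
    · rw [hne a ha, Function.update_self] at hab
      exact absurd hab (hfresh a ha)
    · rw [hne b hb, Function.update_self] at hab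
      exact absurd hab.symm (hfresh b hb)
    · rfl
  · rw [hflag']
    split_ifs with hyx
    · exact ⟨fun _ => ⟨j, by omega, by simp [hyx]⟩, fun _ => one_ne_zero⟩
    · rw [h.flag_iff]
      constructor
      · rintro ⟨g, hg, hgy⟩
        exact ⟨g, by omega, by rw [hne g hg, hgy]⟩
      · rintro ⟨g, hg, hgy⟩
        rcases Nat.lt_succ_iff_lt_or_eq.1 hg with hg | rfl
        · exact ⟨g, hg, by rw [← hgy, hne g hg]⟩
        · exact absurd (by simpa using hgy.symm) hyx

/-- The allocation `out` is feasible, and gives every agent a third of her share. -/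
structure Solved (O : OrderedInstance m n ℓ) (out : ℕ → ℕ) : Prop where
  lt : ∀ g < m, out g < n
  cap : ∀ i < n, ∀ h < ℓ, #{g ∈ range m | out g = i ∧ O.c g = h} ≤ O.k h
  val : ∀ i < n, O.share i ≤ 3 * ∑ g ∈ range m with out g = i, O.v i g

theorem not_live_zero (lo : ℕ → ℕ) (g : ℕ) : ¬ O.Live lo (n - n) g := by
  rintro ⟨h1, h2⟩
  rw [Nat.sub_self, Nat.zero_mul] at h2
  omega

/-- The map `π` is an injection of a finite set into itself, hence a bijection. Passing from slots
to goods along it keeps owners and categories and lowers no owner's value. -/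
theorem Progress.solved {q : ℕ} {lo sat : ℕ → ℕ} (h : O.Progress q n lo own sat)
    (hp : O.Picked own m π out flag) : O.Solved out := by
  have himage : (range m).image π = range m := by
    refine eq_of_subset_of_card_le (fun x hx => ?_) (card_image_of_injOn hp.inj).ge
    obtain ⟨g, hg, rfl⟩ := mem_image.1 hx
    exact mem_range.2 (hp.lt g (mem_range.1 hg))
  have hsurj : ∀ x < m, ∃ g < m, π g = x := fun x hx => by
    have : x ∈ (range m).image π := by simpa [himage] using hx
    simpa using this
  refine ⟨fun x hx => ?_, fun i hi c hc => ?_, fun i hi => ?_⟩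
  · obtain ⟨g, hg, rfl⟩ := hsurj x hx
    rw [hp.out_eq g hg]
    exact h.own_lt g hg (not_live_zero _ _)
  · refine le_trans ?_ (h.cap i hi c hc)
    refine le_trans (card_le_card (t := {g ∈ range m | ¬ O.Live lo (n - n) g ∧ own g = i ∧
      O.c g = c}.image π) fun x hx => ?_) card_image_le
    simp only [mem_filter, mem_range, mem_image] at hx ⊢
    obtain ⟨g, hg, rfl⟩ := hsurj x hx.1
    exact ⟨g, ⟨hg, not_live_zero _ _, by rw [← hp.out_eq g hg, hx.2.1],
      by rw [← hp.cat g hg, hx.2.2]⟩, rfl⟩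
  · have hsat : sat i ≠ 0 := fun h0 => by
      have h1 := h.card
      have h2 : 0 < #{i ∈ range n | sat i = 0} :=
        card_pos.2 ⟨i, mem_filter.2 ⟨mem_range.2 hi, h0⟩⟩
      omega
    refine (h.val i hi hsat).trans (mul_le_mul_of_nonneg_left ?_ (by norm_num))
    have hpick : ∑ x ∈ range m, (if out x = i then O.v i x else 0) =
        ∑ g ∈ range m, if out (π g) = i then O.v i (π g) else 0 := by
      conv_lhs => rw [← himage]
      exact sum_image hp.inj
    rw [sum_filter, sum_filter, hpick]
    refine sum_le_sum fun g hg => ?_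
    rw [mem_range] at hg
    rw [hp.out_eq g hg]
    simp only [not_live_zero, not_false_iff, true_and]
    split_ifs with hi'
    · exact hi' ▸ hp.le g hg
    · exact le_rfl

end OrderedInstance

namespace RAM

open Finset Prog

/-- The good at place `14` of the order of the owner of the slot in cell `13`. -/
def candidate : NExp := .get 4 (.entry 9 (.scalar 13)) (.scalar 14)

/-- The owners of the slots pick goods of the same category, starting with the most valuable
slots. -/
def pickGoods : Prog :=
  forLoop 13 numGoods
    (seq (forLoop 14 (.add (.scalar 13) (.const 1))
        (cond (.and (.eqN (.entry 1 (.scalar 14)) (.entry 1 (.scalar 13)))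
            (.eqN (.entry 20 candidate) (.const 0)))
          (setN 21 (.const 0) (.const 0) candidate)))
      (seq (setN 3 (.scalar 21) (.const 0) (.entry 9 (.scalar 13)))
        (setN 20 (.scalar 21) (.const 0) (.const 1))))

theorem wp_pickGoods {m n ℓ N : ℕ} {O : OrderedInstance m n ℓ} {s : Mem} (hmN : m ≤ N)
    (hs : Stores O s) (hown : ∀ g < m, s.nat 9 g 0 < n) (h20 : ∀ g, s.nat 20 g 0 = 0) :
    pickGoods.wp N (fun s' => ∃ π, O.Picked (s.nat 9 · 0) m π (s'.nat 3 · 0) (s'.nat 20 · 0))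
      s := by
  refine wp_forLoop (fun j s' => ∃ π, O.Picked (s.nat 9 · 0) j π (s'.nat 3 · 0) (s'.nat 20 · 0))
    hmN (by decide) ?_ ?_ ?_ ?_ fun s' _ h => h
  · intro s' hF
    rw [eval_numGoods, hF.nat 0 (by decide), hs.goods]
  · intro j s' x h
    simpa [update_of_ne] using h
  · exact ⟨id, by simp, by simp, by simp, by simp, by simp, by simp [h20]⟩
  · rintro j hj s₁ hF₁ h13 ⟨π, hπ⟩
    have hs₁ : Stores O s₁ := hs.of_frame hF₁ (by decide)
    have h9 : s₁.nat 9 = s.nat 9 := hF₁.nat 9 (by decide)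
    obtain ⟨b₀, hb₀, hcb₀, hfb₀⟩ := hπ.exists_flag_eq_zero hj (hown j hj)
    refine wp_seq (P := fun s' => ∃ b ≤ j, O.c b = O.c j ∧
      s₁.nat 20 (O.σ (s.nat 9 j 0) b) 0 = 0 ∧ s'.nat 21 0 0 = O.σ (s.nat 9 j 0) b) ?_
      fun s₂ hF₂ ⟨b, hb, hcb, hfb, h21⟩ => ?_
    -- The pigeonhole place `b₀` ensures that some candidate is found; later candidates overwrite
    -- it. Any of them will do, since every place up to `j` in the category is worth at least the
    -- slot `j`.
    · refine wp_forLoop (fun b s' => b₀ < b → ∃ b ≤ j, O.c b = O.c j ∧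
        s₁.nat 20 (O.σ (s.nat 9 j 0) b) 0 = 0 ∧ s'.nat 21 0 0 = O.σ (s.nat 9 j 0) b)
        (K := j + 1) (by omega) (by decide) ?_ ?_ ?_ ?_ ?_
      · intro s' hF
        rw [NExp.eval_add, NExp.eval_scalar, hF.nat 13 (by decide), h13, NExp.eval_const]
      · intro b s' x h
        simpa [update_of_ne] using h
      · exact fun h => absurd h (Nat.not_lt_zero _)
      · intro b hb s₂ hF₂ h14 hJ
        have hs₂ : Stores O s₂ := hs₁.of_frame hF₂ (by decide)
        have hcand : candidate.eval s₂ = O.σ (s.nat 9 j 0) b := by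
          rw [candidate, NExp.eval_get, NExp.eval_entry, NExp.eval_scalar, NExp.eval_scalar,
            hF₂.nat 13 (by decide), h13, h14, hF₂.nat 9 (by decide), h9, hs₂.perm]
        have htest : (Test.and (.eqN (.entry 1 (.scalar 14)) (.entry 1 (.scalar 13)))
            (.eqN (.entry 20 candidate) (.const 0))).Holds s₂ ↔
            O.c b = O.c j ∧ s₁.nat 20 (O.σ (s.nat 9 j 0) b) 0 = 0 := by
          simp only [Test.Holds, Test.holds_eqN, NExp.eval_entry, NExp.eval_scalar, hcand, h14,
            hF₂.nat 13 (by decide), h13, hs₂.cat, hF₂.nat 20 (by decide), NExp.eval_const]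
        refine wp_cond (fun h _ => ?_) fun h hb₀b => ?_
        · obtain ⟨h1, h2⟩ := htest.1 h
          refine ⟨b, by omega, h1, h2, ?_⟩
          simp [hcand]
        · rcases Nat.lt_succ_iff_lt_or_eq.1 hb₀b with h' | rfl
          · exact hJ h'
          · exact absurd (htest.2 ⟨hcb₀, hfb₀⟩) h
      · exact fun s' _ h => h (by omega)
    · have h9₂ : s₂.nat 9 = s.nat 9 := by rw [hF₂.nat 9 (by decide), h9]
      have h13₂ : s₂.nat 13 0 0 = j := by rw [hF₂.nat 13 (by decide), h13]
      have hlt : s.nat 9 j 0 < n := hown j hj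
      refine ⟨_, hπ.succ (x := O.σ (s.nat 9 j 0) b) (O.σ_lt _ hlt b (by omega))
        (by rw [O.c_σ _ hlt b (by omega), hcb]) ?_ hfb ?_ ?_⟩
      · rcases hb.eq_or_lt with rfl | hb
        · exact le_rfl
        · exact (O.sorted _ hlt).anti b j hb hj hcb
      · intro y
        simp [update_of_ne, h21, h13₂, h9₂, hF₂.nat 3 (by decide)]
      · intro y
        simp [update_of_ne, h21, hF₂.nat 20 (by decide)]

end RAM

/-! ### From the input to an ordered instance and back -/

namespace FairInstance

open Finset

variable {m n ℓ : ℕ} (I : FairInstance m n ℓ)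

theorem input_goods : I.input.nat 0 0 0 = m := by simp [input]

theorem input_agents : I.input.nat 0 1 0 = n := by simp [input]

theorem input_cats : I.input.nat 0 2 0 = ℓ := by simp [input]

theorem input_cat (g : Fin m) : I.input.nat 1 g 0 = I.cat g := by simp [input]

theorem input_thr (h : Fin ℓ) : I.input.nat 2 h 0 = I.k h := by simp [input]

theorem input_val (i : Fin n) (g : Fin m) : I.input.real 0 i g = I.v i g := by simp [input]

theorem input_nat_of_lt {a : ℕ} (ha : 2 < a) (x y : ℕ) : I.input.nat a x y = 0 := by
  simp [input, show a ≠ 0 by omega, show a ≠ 1 by omega, show a ≠ 2 by omega]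

theorem input_cat_lt {g : ℕ} (hg : g < m) : I.input.nat 1 g 0 < ℓ := by
  rw [show I.input.nat 1 g 0 = I.cat ⟨g, hg⟩ from I.input_cat ⟨g, hg⟩]
  exact (I.cat ⟨g, hg⟩).2

theorem input_val_nonneg (i g : ℕ) : 0 ≤ I.input.real 0 i g := by
  simp only [input]
  split_ifs
  · exact I.v_nonneg _ _
  · exact le_rfl

theorem card_inter_category {S : Finset (Fin m)} (f : ℕ → ℕ) {x : ℕ}
    (hS : ∀ g : Fin m, g ∈ S ↔ f g = x) (h : Fin ℓ) :
    #(S ∩ I.category h) = #{g ∈ range m | f g = x ∧ I.input.nat 1 g 0 = h} := by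
  rw [card_filter, sum_range, ← card_filter]
  congr 1
  ext g
  simp [category, hS, input_cat, Fin.val_inj]

theorem value_eq_sum {S : Finset (Fin m)} (f : ℕ → ℕ) {x : ℕ}
    (hS : ∀ g : Fin m, g ∈ S ↔ f g = x) (i : Fin n) :
    I.value i S = ∑ g ∈ range m with f g = x, I.input.real 0 i g := by
  rw [sum_filter, sum_range, value]
  simp only [input_val, ← hS]
  rw [sum_ite_mem, univ_inter]

theorem exists_owner {A : Fin n → Finset (Fin m)} (hA : A ∈ I.feasible) :
    ∃ a : ℕ → ℕ, (∀ g < m, a g < n) ∧ ∀ (g : Fin m) (i : Fin n), g ∈ A i ↔ a g = i := by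
  choose f hf hu using hA.1
  refine ⟨fun g => if hg : g < m then f ⟨g, hg⟩ else 0, fun g hg => ?_, fun g i => ?_⟩
  · simp [hg]
  · simp only [g.2, dif_pos, Fin.eta, Fin.val_inj]
    exact ⟨fun h => (hu g i h).symm, fun h => h ▸ hf g⟩

theorem feasible_cap {A : Fin n → Finset (Fin m)} (hA : A ∈ I.feasible) {a : ℕ → ℕ}
    (ha : ∀ (g : Fin m) (i : Fin n), g ∈ A i ↔ a g = i) {i h : ℕ} (hi : i < n) (hh : h < ℓ) :
    #{g ∈ range m | a g = i ∧ I.input.nat 1 g 0 = h} ≤ I.input.nat 2 h 0 := by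
  have h1 := hA.2 ⟨i, hi⟩ ⟨h, hh⟩
  rw [I.card_inter_category a (fun g => ha g ⟨i, hi⟩), ← input_thr] at h1
  exact h1

/-- A feasible allocation splits each category into `n` parts within its threshold, so the initial
windows contain all goods. -/
theorem offset_lt_mul (hne : I.feasible.Nonempty) {g : ℕ} (hg : g < m) :
    offset (I.input.nat 1 · 0) g < n * I.input.nat 2 (I.input.nat 1 g 0) 0 := by
  obtain ⟨A, hA⟩ := hne
  obtain ⟨a, ha, haA⟩ := I.exists_owner hA
  have h1 : offset (I.input.nat 1 · 0) g <
      #{b ∈ range m | I.input.nat 1 b 0 = I.input.nat 1 g 0} := by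
    unfold offset
    rw [← Nat.count_eq_card_filter_range]
    exact Nat.count_strict_mono rfl hg
  refine h1.trans_le ?_
  rw [card_eq_sum_card_fiberwise (f := a) (t := range n)]
  · refine (sum_le_card_nsmul _ _ (I.input.nat 2 (I.input.nat 1 g 0) 0) fun i hi => ?_).trans_eq ?_
    · refine le_trans (card_le_card fun b hb => ?_)
        (I.feasible_cap hA haA (mem_range.1 hi) (I.input_cat_lt hg))
      simp only [mem_filter] at hb ⊢
      exact ⟨hb.1.1, hb.2, hb.1.2⟩
    · simp
  · intro b hb
    simp only [coe_filter, mem_range, Set.mem_ofPred_eq] at hb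
    simpa using ha b hb.1

/-- The ordered instance of an instance whose goods have been sorted by `σ`. -/
noncomputable def ordered (hne : I.feasible.Nonempty) (σ : ℕ → ℕ → ℕ)
    (hσ : ∀ i < n, KeepsCategory m (I.input.nat 1 · 0) (σ i) ∧
      SortedUpTo m (I.input.nat 1 · 0) (I.input.real 0 i) (σ i) m) :
    OrderedInstance m n ℓ where
  c := (I.input.nat 1 · 0)
  k := (I.input.nat 2 · 0)
  v := I.input.real 0
  σ := σ
  share i := if hi : i < n then I.CMMS ⟨i, hi⟩ else 0
  c_lt _ := I.input_cat_lt
  offset_lt _ := I.offset_lt_mul hne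
  σ_lt i hi := (hσ i hi).1.lt
  c_σ i hi := (hσ i hi).1.cat
  σ_inj i hi := (hσ i hi).1.inj
  sorted i hi := ⟨fun _ _ => I.input_val_nonneg _ _,
    fun g g' hgg' hg' => (hσ i hi).2 g (hgg'.trans hg') g' hgg' hg'⟩
  share_le i hi lo r hr := by
    have hw : SortedValues m (I.input.nat 1 · 0) fun g => I.input.real 0 i (σ i g) :=
      ⟨fun _ _ => I.input_val_nonneg _ _,
        fun g g' hgg' hg' => (hσ i hi).2 g (hgg'.trans hg') g' hgg' hg'⟩
    rcases Nat.eq_zero_or_pos (n - r) with h0 | hpos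
    · rw [h0, Nat.cast_zero, zero_mul]
      exact sum_nonneg fun _ _ => I.input_val_nonneg _ _
    have hpos' : (0 : ℝ) < (n - r : ℕ) := by exact_mod_cast hpos
    rw [dif_pos hi, mul_comm, ← le_div_iff₀ hpos']
    have := hne.to_subtype
    -- The share is a supremum over a nonempty set, so it is enough to bound the worst bundle of
    -- each feasible `P`.
    refine ciSup_le fun P => ?_
    rw [le_div_iff₀ hpos', mul_comm]
    obtain ⟨a, ha, haP⟩ := I.exists_owner P.2
    refine hw.mul_le_total (a := a) (fun g hg => I.input_cat_lt hg) (hσ i hi).1.lt (hσ i hi).1.cat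
      (hσ i hi).1.inj (fun j hj h hh => I.feasible_cap P.2 haP hj hh) (fun j hj => ?_) hr
    refine (ciInf_le (Set.finite_range _).bddBelow ⟨j, hj⟩).trans_eq ?_
    exact I.value_eq_sum a (fun g => haP g ⟨j, hj⟩) ⟨i, hi⟩

theorem isMMS_bundles (hne : I.feasible.Nonempty) {σ : ℕ → ℕ → ℕ}
    (hσ : ∀ i < n, KeepsCategory m (I.input.nat 1 · 0) (σ i) ∧
      SortedUpTo m (I.input.nat 1 · 0) (I.input.real 0 i) (σ i) m) {s : RAM.Mem}
    (h : (I.ordered hne σ hσ).Solved (s.nat 3 · 0)) : I.IsMMS (1 / 3) (s.bundles m n) := by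
  have hmem : ∀ (i : Fin n) (g : Fin m), g ∈ s.bundles m n i ↔ s.nat 3 g 0 = i := by
    intro i g
    simp [RAM.Mem.bundles]
  refine ⟨⟨fun g => ⟨⟨s.nat 3 g 0, h.lt g g.2⟩, by simp [hmem], fun j hj => ?_⟩, fun i c => ?_⟩,
    fun i => ?_⟩
  · exact Fin.ext ((hmem j g).1 hj).symm
  · rw [I.card_inter_category (s.nat 3 · 0) (hmem i), ← input_thr]
    exact h.cap i i.2 c c.2
  · have h1 : I.CMMS i ≤ 3 * ∑ g ∈ range m with s.nat 3 g 0 = i, I.input.real 0 i g := by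
      have := h.val i i.2
      simpa only [ordered, i.2, dif_pos, Fin.eta] using this
    rw [I.value_eq_sum (s.nat 3 · 0) (hmem i)]
    linarith

end FairInstance

/-! ### The complete algorithm -/

namespace RAM

open Prog

/-- The algorithm. -/
def maximinProgram : Prog :=
  seq sortGoods (seq computeOffsets (seq computeCapacities (seq allocateSlots pickGoods)))

/-- Every loop limit is at most one of `m`, `n`, `ℓ`, so `m + n + ℓ` bounds all iteration counts.
The working arrays need no initialisation because the input leaves them `0`. -/
theorem wp_maximinProgram {m n ℓ : ℕ} (I : FairInstance m n ℓ) (hne : I.feasible.Nonempty) :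
    maximinProgram.wp (m + n + ℓ) (fun s => I.IsMMS (1 / 3) (s.bundles m n)) I.input := by
  refine wp_seq (wp_sortGoods I.input_goods I.input_agents (by omega) (by omega))
    fun s₁ hF₁ hσ => ?_
  refine wp_seq (wp_computeOffsets (by rw [hF₁.nat 0 (by decide), I.input_goods]) (by omega)
    fun g => by rw [hF₁.nat 5 (by decide), I.input_nat_of_lt (by omega)]) fun s₂ hF₂ hoff => ?_
  refine wp_seq (wp_computeCapacities (n := n) (ℓ := ℓ)
    (by rw [hF₂.nat 0 (by decide), hF₁.nat 0 (by decide), I.input_agents])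
    (by rw [hF₂.nat 0 (by decide), hF₁.nat 0 (by decide), I.input_cats]) (by omega) (by omega)
    fun h => by rw [hF₂.nat 7 (by decide), hF₁.nat 7 (by decide), I.input_nat_of_lt (by omega)])
    fun s₃ hF₃ hcap => ?_
  have hk₃ : ∀ a ∈ [0, 1, 2, 3, 6, 9, 10, 19, 20], s₃.nat a = I.input.nat a := fun a ha => by
    rw [hF₃.nat a (by revert a; decide), hF₂.nat a (by revert a; decide),
      hF₁.nat a (by revert a; decide)]
  set O := I.ordered hne (s₁.nat 4) hσ with hO
  have hs₃ : Stores O s₃ := by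
    refine ⟨by rw [hk₃ 0 (by simp), I.input_goods], by rw [hk₃ 0 (by simp), I.input_agents],
      by rw [hk₃ 0 (by simp), I.input_cats], fun g => by rw [hk₃ 1 (by simp)]; rfl,
      fun h => by rw [hk₃ 2 (by simp)]; rfl, fun i g => ?_, fun g hg => ?_, fun i g => ?_⟩
    · rw [hF₃.nat 4 (by decide), hF₂.nat 4 (by decide)]
      rfl
    · rw [hF₃.nat 5 (by decide), hoff g hg, hF₁.nat 1 (by decide)]
      rfl
    · rw [hF₃.real 0 (by decide), hF₂.real 0 (by decide), hF₁.real 0 (by decide)]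
      rfl
  have h0 : ∀ a ∈ [6, 9, 10, 19, 20], ∀ x, s₃.nat a x 0 = 0 := fun a ha x => by
    rw [hk₃ a (by revert a; decide), I.input_nat_of_lt (by revert a; decide)]
  refine wp_seq (wp_allocateSlots (by omega) (by omega) (by omega) hs₃ (fun h hh => ?_) ?_)
    fun s₄ hF₄ hprog => ?_
  · rw [hcap h hh, hF₂.nat 2 (by decide), hF₁.nat 2 (by decide)]
    rfl
  · rw [h0 19 (by simp)]
    exact OrderedInstance.Progress.zero (h0 6 (by simp)) (h0 10 (by simp))
  · have hs₄ : Stores O s₄ := hs₃.of_frame hF₄ (by decide)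
    refine wp_mono (wp_pickGoods (by omega) hs₄
      (fun g hg => hprog.own_lt g hg (OrderedInstance.not_live_zero _ _))
      fun g => by rw [hF₄.nat 20 (by decide), h0 20 (by simp)]) fun s' ⟨π, hπ⟩ => ?_
    exact I.isMMS_bundles hne hσ (hprog.solved hπ)

end RAM

/-- There is a program that, on every fair division instance with additive valuations and
cardinality constraints that has a feasible allocation, finds a `1/3`-MMS allocation within a number
of steps that is polynomial in the numbers of goods, agents and categories. -/
theorem theorem2 :
    ∃ (prog : RAM.Prog) (T : Polynomial ℕ),
      ∀ (m n ℓ : ℕ) (I : FairInstance m n ℓ), I.feasible.Nonempty →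
        ∃ (t : ℕ) (s : RAM.Mem),
          RAM.Exec prog I.input t s ∧ t ≤ T.eval (m + n + ℓ) ∧
            I.IsMMS (1 / 3) (s.bundles m n) := by
  obtain ⟨T, hT⟩ := RAM.maximinProgram.exists_polynomial_bound
  refine ⟨RAM.maximinProgram, T, fun m n ℓ I hne => ?_⟩
  rw [hT]
  exact RAM.Prog.exists_exec_of_wp (RAM.wp_maximinProgram I hne)
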